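/- Let $n\in\mathbb N$ and let $C=C((-\infty,0],\mathbb R^n)$ be the Fréchet space of continuous maps with the topology of locally uniform convergence. For $g:U\to W$ on an open subset $U$ of a topological vector space $V$, put $Dg(u)v=\lim_{0\ne h\to0}\frac1h(g(u+hv)-g(u))$. A continuous map $g$ is $C^1_{MB}$-smooth if all $Dg(u)v$ ($u\in U$, $v\in V$) exist and $(u,v)\mapsto Dg(u)v$ is continuous on $U\times V$; it is $C^1_F$-smooth if all $Dg(u)v$ exist, each $Dg(u):V\to W$ is linear and continuous, and $u\mapsto Dg(u)$ is continuous with respect to uniform convergence on bounded sets. Let $U\subset C$ be open and let $f:U\to\mathbb R^n$ be $C^1_{MB}$-smooth or $C^1_F$-smooth. For a function $x$ write $x_t(s)=x(t+s)$, $s\le0$. A solution of $x'(t)=f(x_t)$ on an interval $I$ is a continuous map $x:(-\infty,0]+I\to\mathbb R^n$ with $x_t\in U$ for all $t\in I$ such that $x|_I$ is differentiable with $x'(t)=f(x_t)$ for all $t\in I$ (one-sided derivatives at endpoints of $I$ belonging to $I$). For $\phi\in U$ let $t_\phi\le\infty$ be the supremum of all $t>0$ such that there is a solution on $[0,t]$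 with $x_0=\phi$. Define $x^\phi:(-\infty,t_\phi)\to\mathbb R^n$ by $x^\phi=\phi$ on $(-\infty,0]$, and $x^\phi(t)=x(t)$ for $0<t<t_\phi$, where $x$ is any solution on some $[0,t']$, $t<t'<t_\phi$, with $x_0=\phi$. For $t\ge0$ let $\Omega_t=\{\phi\in U:t<t_\phi\}$ and $\Sigma_t(\phi)=x^\phi_t$ for $\phi\in\Omega_t$. **Proposition 5.2.** Let $\phi\in U$ and $\hat\phi\in C$. The objects above are well-defined: $t_\phi>0$, $x^\phi$ does not depend on the choice of the solutions $x$ in its definition and is a solution on $[0,t_\phi)$ with $x^\phi_0=\phi$, and for every $t\in[0,t_\phi)$ the set $\Omega_t$ is open in $C$ and $D\Sigma_t(\phi)\chi\in C$ exists for every $\chi\in C$. Define $v:(-\infty,t_\phi)\to\mathbb R^n$ by $v(t)=\hat\phi(t)$ for $t<0$ and $v(t)=(D\Sigma_t(\phi)\hat\phi)(0)$ for $0\le t<t_\phi$. Then $v_t=D\Sigma_t(\phi)\hat\phi$ for every $t\in[0,t_\phi)$; in particular $v_0=\hat\phi$. The map $v$ is continuous, its restriction to $[0,t_\phi)$ is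 differentiable, and $$v'(t)=Df(x^\phi_t)v_t\quad\text{for every }t\in[0,t_\phi),$$ with the right derivative at $t=0$. -/

import Mathlib

open Set Filter Topology
open scoped Pointwise

noncomputable section

namespace DelayEq

section Calculus

variable {V W : Type*} [AddCommGroup V] [Module ℝ V] [TopologicalSpace V]
  [AddCommGroup W] [Module ℝ W] [TopologicalSpace W]

/-- `g` has the directional derivative `w` at `u` in direction `v`:
`(g (u + h v) - g u) / h → w` as `0 ≠ h → 0`. -/
def HasDirDeriv (g : V → W) (u v : V) (w : W) : Prop :=
  Tendsto (fun h : ℝ => h⁻¹ • (g (u + h • v) - g u)) (𝓝[≠] 0) (𝓝 w)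

/-- `g` has some directional derivative at `u` in direction `v`. -/
def DirDifferentiableAt (g : V → W) (u v : V) : Prop :=
  ∃ w, HasDirDeriv g u v w

/-- The directional derivative `Dg(u)v` (meaningful only if `DirDifferentiableAt g u v`). -/
def dirDeriv (g : V → W) (u v : V) : W :=
  limUnder (𝓝[≠] (0 : ℝ)) (fun h : ℝ => h⁻¹ • (g (u + h • v) - g u))

/-- Continuous differentiability in the sense of Michal and Bastiani on the (open) set `U`:
`g` is continuous on `U`, all directional derivatives exist, and `(u, v) ↦ Dg(u)v` is
continuous on `U × V`. -/
def IsC1MB (g : V → W) (U : Set V) : Prop :=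
  ContinuousOn g U ∧
  (∀ u ∈ U, ∀ v, DirDifferentiableAt g u v) ∧
  ContinuousOn (fun p : V × V => dirDeriv g p.1 p.2) (U ×ˢ univ)

/-- Continuous differentiability in the sense of Fréchet on the (open) set `U`:
`g` is continuous on `U`, all directional derivatives exist, each `Dg(u)` is linear and
continuous, and `u ↦ Dg(u)` is continuous for the topology of uniform convergence on bounded
sets, which is the topology that `V →L[ℝ] W` carries. -/
def IsC1F [IsTopologicalAddGroup W] [ContinuousConstSMul ℝ W] (g : V → W) (U : Set V) : Prop :=
  ContinuousOn g U ∧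
  ∃ D : V → (V →L[ℝ] W),
    (∀ u ∈ U, ∀ v, HasDirDeriv g u v (D u v)) ∧ ContinuousOn D U

end Calculus

/-- The Fréchet space `C((-∞,0], ℝⁿ)`; its topology is the compact-open topology, that is,
the topology of locally uniform convergence. -/
abbrev Hist (n : ℕ) : Type := C(Iic (0 : ℝ), EuclideanSpace ℝ (Fin n))

variable {n : ℕ}

open Classical in
/-- The segment `x_t : s ↦ x (t + s)`, `s ≤ 0`, of a function which is continuous on `(-∞, t]`
(the value `0` is used if `x` is not continuous there). -/
def seg (x : ℝ → EuclideanSpace ℝ (Fin n)) (t : ℝ) : Hist n :=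
  if h : Continuous (fun s : Iic (0 : ℝ) => x (t + s)) then ⟨fun s => x (t + s), h⟩ else 0

/-- `x` is a solution of `x'(t) = f(x_t)` on the interval `I`: it is continuous on
`(-∞,0] + I`, its segments `x_t`, `t ∈ I`, belong to `U`, and `x|_I` is differentiable with
`x'(t) = f(x_t)` for all `t ∈ I`. Only the values of `x` on `(-∞,0] + I` matter, and only the
values of `f` on `U`. -/
def IsSolution (f : Hist n → EuclideanSpace ℝ (Fin n)) (U : Set (Hist n))
    (x : ℝ → EuclideanSpace ℝ (Fin n)) (I : Set ℝ) : Prop :=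
  ContinuousOn x (Iic (0 : ℝ) + I) ∧
  ∀ t ∈ I, seg x t ∈ U ∧ HasDerivWithinAt x (f (seg x t)) I t

/-- `t_φ`, the supremum in `[-∞, ∞]` of all `t > 0` such that there is a solution on `[0,t]`
with `x_0 = φ`. -/
def tmax (f : Hist n → EuclideanSpace ℝ (Fin n)) (U : Set (Hist n)) (φ : Hist n) : EReal :=
  sSup {T : EReal | ∃ t : ℝ, T = (t : EReal) ∧ 0 < t ∧
    ∃ x : ℝ → EuclideanSpace ℝ (Fin n), IsSolution f U x (Icc 0 t) ∧ seg x 0 = φ}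

/-- The interval `[0, t_φ)`. -/
def lifespan (f : Hist n → EuclideanSpace ℝ (Fin n)) (U : Set (Hist n)) (φ : Hist n) : Set ℝ :=
  {t : ℝ | 0 ≤ t ∧ (t : EReal) < tmax f U φ}

/-- The maximal solution `x^φ`: it equals `φ` on `(-∞,0]`, and for `0 < t < t_φ` its value at
`t` is `x t`, where `x` is any solution on some `[0,t']`, `t < t' < t_φ`, with `x_0 = φ`. -/
def maxSol (f : Hist n → EuclideanSpace ℝ (Fin n)) (U : Set (Hist n)) (φ : Hist n)
    (t : ℝ) : EuclideanSpace ℝ (Fin n) :=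
  if ht : t ≤ 0 then φ ⟨t, ht⟩
  else Classical.epsilon (fun y : EuclideanSpace ℝ (Fin n) =>
    ∃ t' : ℝ, t < t' ∧ (t' : EReal) < tmax f U φ ∧
      ∃ x : ℝ → EuclideanSpace ℝ (Fin n),
        IsSolution f U x (Icc 0 t') ∧ seg x 0 = φ ∧ y = x t)

/-- `Ω_t = {φ ∈ U : t < t_φ}`, the domain of the solution operator `Σ_t`. -/
def solDomain (f : Hist n → EuclideanSpace ℝ (Fin n)) (U : Set (Hist n)) (t : ℝ) :
    Set (Hist n) :=
  {φ : Hist n | φ ∈ U ∧ (t : EReal) < tmax f U φ}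

/-- The solution operator `Σ_t(φ) = x^φ_t` (meaningful for `t ≥ 0` and `φ ∈ Ω_t`). -/
def solOp (f : Hist n → EuclideanSpace ℝ (Fin n)) (U : Set (Hist n)) (t : ℝ) (φ : Hist n) :
    Hist n :=
  seg (maxSol f U φ) t

/-- The function `v`: equal to `ψ` on `(-∞,0)`, and to `(DΣ_t(φ)ψ)(0)` for `0 ≤ t < t_φ`
(its values at `t ≥ t_φ` are irrelevant). -/
def linSol (f : Hist n → EuclideanSpace ℝ (Fin n)) (U : Set (Hist n)) (φ ψ : Hist n)
    (t : ℝ) : EuclideanSpace ℝ (Fin n) :=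
  if ht : t < 0 then ψ ⟨t, ht.le⟩
  else dirDeriv (solOp f U t) φ ψ ⟨0, mem_Iic.2 le_rfl⟩

end DelayEq

end

/-! Near every compact subset of `U`, continuity of `(u, v) ↦ Df(u)v` at points `(u, 0)` yields a
bound `‖Df(u)v‖ ≤ L sup_{[-R, 0]} ‖v‖` with some finite `R` (`DelayEq.exists_isTube`). Hence,
although histories live on `(-∞, 0]`, near a trajectory the equation has bounded delay and a
Lipschitz continuous right-hand side. On the Fréchet space of histories, which is first countable,
Fréchet smoothness implies Michal-Bastiani smoothness (`DelayEq.IsC1F.isC1MB`), so that both cases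
are covered.

Truncating `f` around a curve of histories gives a globally Lipschitz equation, which is solved by
Banach's fixed point theorem in a weighted sup-norm (`DelayEq.exists_solution_of_lipschitz`).
Together with a Gronwall inequality for delay equations (`DelayEq.norm_le_of_norm_deriv_le_delay`),
this gives local existence, uniqueness, and the fact that solutions with initial data close to `φ`
exist as long as a given solution through `φ` and stay close to it
(`DelayEq.IsTube.exists_solution_near`); openness of the domains follows.

The existence theorem also provides a solution `v` of the variational equation
`v'(t) = Df(x_t)v_t` with `v_0 = χ`. Taylor's formula, uniform along the compact trajectory, shows
that `x + τ v` solves the equation up to an error `o(τ)`, and by Gronwall's inequality the solution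
with initial value `φ + τ χ` is `x + τ v + o(τ)`, uniformly on `(-∞, T]`
(`DelayEq.exists_variational_solution_tendsto`). So the segments `v_t` are the derivatives of the
solution operators. -/

namespace DelayEq

variable {n : ℕ}

/-! ### The space of histories -/

/-- The neighbourhood of `u` consisting of the histories which are closer to `u` than `r`,
uniformly on `[-R, 0]`. -/
def histBall (u : Hist n) (R r : ℝ) : Set (Hist n) :=
  {w | ∀ s : Iic (0 : ℝ), -R ≤ (s : ℝ) → ‖w s - u s‖ < r}

theorem isCompact_ge_in_Iic (R : ℝ) : IsCompact {s : Iic (0 : ℝ) | -R ≤ (s : ℝ)} := by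
  rw [Subtype.isCompact_iff]
  convert isCompact_Icc (a := -R) (b := (0 : ℝ)) using 1
  ext t
  simp only [mem_image, mem_ofPred_eq, Subtype.exists, exists_and_left, exists_prop, mem_Iic,
    mem_Icc]
  constructor
  · rintro ⟨s, h1, h2, rfl⟩
    exact ⟨h1, h2⟩
  · rintro ⟨h1, h2⟩
    exact ⟨t, h1, h2, rfl⟩

theorem histBall_mem_nhds (u : Hist n) (R : ℝ) {r : ℝ} (hr : 0 < r) :
    histBall u R r ∈ 𝓝 u := by
  have h := ContinuousMap.tendsto_iff_forall_isCompact_tendstoUniformlyOn.1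
    (tendsto_id : Tendsto id (𝓝 u) (𝓝 u)) _ (isCompact_ge_in_Iic R)
  filter_upwards [Metric.tendstoUniformlyOn_iff.1 h r hr] with w hw s hs
  have := hw s hs
  rwa [dist_comm, dist_eq_norm] at this

theorem exists_histBall_subset {u : Hist n} {N : Set (Hist n)} (hN : N ∈ 𝓝 u) :
    ∃ R r : ℝ, 0 < R ∧ 0 < r ∧ histBall u R r ⊆ N := by
  obtain ⟨V, hV, hVN⟩ := UniformSpace.mem_nhds_iff.1 hN
  obtain ⟨⟨K, r⟩, ⟨hK, hr⟩, hKV⟩ :=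
    Metric.uniformity_basis_dist.compactConvergenceUniformity.mem_iff.1 hV
  obtain ⟨R, hR⟩ := ((hK.image continuous_subtype_val).isBounded).subset_closedBall 0
  refine ⟨max R 1, r, by positivity, hr, fun w hw => hVN (hKV ?_)⟩
  intro s hs
  have h1 : (s : ℝ) ∈ Metric.closedBall (0 : ℝ) R := hR (mem_image_of_mem _ hs)
  rw [mem_closedBall_zero_iff, Real.norm_eq_abs] at h1
  have h2 := hw s (by have := neg_abs_le (s : ℝ); have := le_max_left R 1; linarith)
  change dist (u s) (w s) < r
  rwa [dist_comm, dist_eq_norm]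

instance : FirstCountableTopology (Hist n) := by
  have : LocallyCompactSpace (Iic (0 : ℝ)) := isClosed_Iic.locallyCompactSpace
  have : SigmaCompactSpace (Iic (0 : ℝ)) :=
    (isClosed_Iic (a := (0 : ℝ))).isClosedEmbedding_subtypeVal.sigmaCompactSpace
  infer_instance

/-! ### Segments -/

theorem seg_congr {x y : ℝ → EuclideanSpace ℝ (Fin n)} {t : ℝ} (h : EqOn x y (Iic t)) :
    seg x t = seg y t := by
  have h' : (fun s : Iic (0 : ℝ) => x (t + s)) = fun s : Iic (0 : ℝ) => y (t + s) := by
    funext s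
    exact h (by have := s.2; simp only [mem_Iic] at this ⊢; linarith)
  unfold seg
  by_cases hc : Continuous fun s : Iic (0 : ℝ) => y (t + s)
  · rw [dif_pos (h' ▸ hc), dif_pos hc]
    ext1 s
    exact congrFun h' s
  · rw [dif_neg (h' ▸ hc), dif_neg hc]

theorem seg_apply_of_continuousOn {x : ℝ → EuclideanSpace ℝ (Fin n)} {t : ℝ}
    (hx : ContinuousOn x (Iic t)) (s : Iic (0 : ℝ)) : seg x t s = x (t + s) := by
  have h : Continuous fun s : Iic (0 : ℝ) => x (t + s) := by
    refine hx.comp_continuous (by fun_prop) fun s => ?_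
    have := s.2
    simp only [mem_Iic] at this ⊢
    linarith
  simp [seg, h]

theorem seg_apply {x : ℝ → EuclideanSpace ℝ (Fin n)} (hx : Continuous x) (t : ℝ)
    (s : Iic (0 : ℝ)) : seg x t s = x (t + s) :=
  seg_apply_of_continuousOn hx.continuousOn s

theorem continuous_seg {x : ℝ → EuclideanSpace ℝ (Fin n)} (hx : Continuous x) :
    Continuous (seg x) := by
  let g : C(ℝ × Iic (0 : ℝ), EuclideanSpace ℝ (Fin n)) :=
    ⟨fun p => x (p.1 + p.2), by fun_prop⟩
  have : seg x = g.curry := by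
    funext t
    ext1 s
    exact seg_apply hx t s
  rw [this]
  exact g.curry.continuous

theorem seg_zero_eq_iff {x : ℝ → EuclideanSpace ℝ (Fin n)} (hx : ContinuousOn x (Iic 0))
    {φ : Hist n} : seg x 0 = φ ↔ ∀ s : Iic (0 : ℝ), x s = φ s := by
  constructor
  · rintro rfl s
    rw [seg_apply_of_continuousOn hx, zero_add]
  · intro h
    ext1 s
    rw [seg_apply_of_continuousOn hx, zero_add, h]

theorem Iic_zero_add_Icc {T : ℝ} (hT : 0 ≤ T) : Iic (0 : ℝ) + Icc 0 T = Iic T := by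
  ext t
  rw [Set.mem_add]
  constructor
  · rintro ⟨a, ha, b, hb, rfl⟩
    simp only [mem_Iic, mem_Icc] at *
    linarith
  · intro ht
    exact ⟨t - T, by simpa using ht, T, ⟨hT, le_rfl⟩, by ring⟩

/-! ### Solutions on compact intervals -/

section Solutions

variable {f : Hist n → EuclideanSpace ℝ (Fin n)} {U : Set (Hist n)}
  {x y : ℝ → EuclideanSpace ℝ (Fin n)} {T : ℝ}

theorem IsSolution.continuousOn_Iic (h : IsSolution f U x (Icc 0 T)) (hT : 0 ≤ T) :
    ContinuousOn x (Iic T) := by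
  simpa [Iic_zero_add_Icc hT] using h.1

theorem IsSolution.congr (h : IsSolution f U x (Icc 0 T)) (hT : 0 ≤ T)
    (hxy : EqOn y x (Iic T)) : IsSolution f U y (Icc 0 T) := by
  refine ⟨?_, fun t ht => ?_⟩
  · rw [Iic_zero_add_Icc hT]
    exact (h.continuousOn_Iic hT).congr hxy
  · have hs : seg y t = seg x t := seg_congr (hxy.mono (Iic_subset_Iic.2 ht.2))
    rw [hs]
    exact ⟨(h.2 t ht).1, (h.2 t ht).2.congr (fun s hs => hxy hs.2) (hxy ht.2)⟩

theorem IsSolution.mono {S : ℝ} (h : IsSolution f U x (Icc 0 T)) (hS : 0 ≤ S) (hST : S ≤ T) :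
    IsSolution f U x (Icc 0 S) := by
  refine ⟨?_, fun t ht => ?_⟩
  · rw [Iic_zero_add_Icc hS]
    exact (h.continuousOn_Iic (hS.trans hST)).mono (Iic_subset_Iic.2 hST)
  · have := h.2 t ⟨ht.1, ht.2.trans hST⟩
    exact ⟨this.1, this.2.mono (Icc_subset_Icc_right hST)⟩

/-- Freezing a solution after time `T` gives a continuous function on the whole line. -/
theorem IsSolution.exists_continuous (h : IsSolution f U x (Icc 0 T)) (hT : 0 ≤ T) :
    ∃ y, Continuous y ∧ EqOn y x (Iic T) ∧ IsSolution f U y (Icc 0 T) := by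
  have hE : EqOn (fun t => x (min t T)) x (Iic T) := fun t ht => by
    simp [min_eq_left (mem_Iic.1 ht)]
  refine ⟨fun t => x (min t T), ?_, hE, h.congr hT hE⟩
  exact (h.continuousOn_Iic hT).comp_continuous (by fun_prop) fun t => mem_Iic.2 (min_le_right _ _)

end Solutions

/-! ### Directional derivatives -/

section Calculus

variable {V W : Type*} [AddCommGroup V] [Module ℝ V]
  [AddCommGroup W] [Module ℝ W] [TopologicalSpace W]

theorem HasDirDeriv.dirDeriv_eq [T2Space W] {g : V → W} {u v : V} {w : W}
    (h : HasDirDeriv g u v w) : dirDeriv g u v = w :=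
  Tendsto.limUnder_eq h

theorem DirDifferentiableAt.hasDirDeriv [T2Space W] {g : V → W} {u v : V}
    (h : DirDifferentiableAt g u v) : HasDirDeriv g u v (dirDeriv g u v) := by
  obtain ⟨w, hw⟩ := h
  rwa [hw.dirDeriv_eq]

theorem HasDirDeriv.const_smul [ContinuousConstSMul ℝ W] {g : V → W} {u v : V} {w : W}
    (h : HasDirDeriv g u v w) {c : ℝ} (hc : c ≠ 0) : HasDirDeriv g u (c • v) (c • w) := by
  have h1 : Tendsto (fun t : ℝ => t * c) (𝓝[≠] 0) (𝓝[≠] 0) := by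
    refine tendsto_nhdsWithin_iff.2 ⟨?_, ?_⟩
    · have : Tendsto (fun t : ℝ => t * c) (𝓝 0) (𝓝 (0 * c)) :=
        (continuous_mul_const c).tendsto 0
      rw [zero_mul] at this
      exact this.mono_left nhdsWithin_le_nhds
    · filter_upwards [self_mem_nhdsWithin] with t ht
      exact mul_ne_zero ht hc
  refine ((h.comp h1).const_smul c).congr fun t => ?_
  rw [Function.comp_apply, mul_smul, smul_smul, mul_inv, mul_left_comm, mul_inv_cancel₀ hc,
    mul_one]

end Calculus

/-- On a first countable space, Fréchet `C¹`-smoothness implies Michal-Bastiani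
`C¹`-smoothness: a convergent sequence is bounded, hence `Df(u_k)v_k - Df(u)v_k → 0` whenever
`u_k → u` and `v_k → v`. -/
theorem IsC1F.isC1MB {V W : Type*} [AddCommGroup V] [Module ℝ V] [TopologicalSpace V]
    [IsTopologicalAddGroup V] [ContinuousSMul ℝ V] [FirstCountableTopology V]
    [NormedAddCommGroup W] [NormedSpace ℝ W]
    {g : V → W} {U : Set V} (h : IsC1F g U) : IsC1MB g U := by
  obtain ⟨hg, D, hD, hDc⟩ := h
  refine ⟨hg, fun u hu v => ⟨_, hD u hu v⟩, ?_⟩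
  have key : ContinuousOn (fun p : V × V => D p.1 p.2) (U ×ˢ univ) := by
    rintro ⟨u, v⟩ ⟨hu, -⟩
    refine tendsto_of_seq_tendsto fun p hp => ?_
    have hp' := tendsto_nhdsWithin_iff.1 hp
    have h1 : Tendsto (fun k => (p k).1) atTop (𝓝[U] u) :=
      tendsto_nhdsWithin_iff.2 ⟨(continuous_fst.tendsto _).comp hp'.1,
        hp'.2.mono fun k hk => hk.1⟩
    have h2 : Tendsto (fun k => (p k).2) atTop (𝓝 v) := (continuous_snd.tendsto _).comp hp'.1
    have h3 : Tendsto (fun k => D (p k).1) atTop (𝓝 (D u)) := (hDc u hu).tendsto.comp h1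
    have h4 := (UniformConvergenceCLM.tendsto_iff_tendstoUniformlyOn (RingHom.id ℝ) W
      {S | Bornology.IsVonNBounded ℝ S}).1 h3 _ (h2.isVonNBounded_range ℝ)
    have h5 : Tendsto (fun k => D u (p k).2) atTop (𝓝 (D u v)) :=
      ((D u).continuous.tendsto v).comp h2
    refine Metric.tendsto_atTop'.2 fun ε hε => ?_
    obtain ⟨N, hN⟩ := (((Metric.tendstoUniformlyOn_iff.1 h4 (ε / 2) (half_pos hε))).and
      (Metric.tendsto_nhds.1 h5 (ε / 2) (half_pos hε))).exists_forall_of_atTop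
    refine ⟨N, fun k hk => ?_⟩
    obtain ⟨h6, h7⟩ := hN k hk.le
    have h8 := h6 _ (mem_range_self k)
    rw [dist_comm] at h8
    calc dist (D (p k).1 (p k).2) (D u v)
        ≤ dist (D (p k).1 (p k).2) (D u (p k).2) + dist (D u (p k).2) (D u v) :=
          dist_triangle _ _ _
      _ < ε := by linarith [show dist (D (p k).1 (p k).2) (D u (p k).2) < ε / 2 from h8]
  exact key.congr fun p hp => (hD p.1 hp.1 p.2).dirDeriv_eq

section MeanValue

variable {V W : Type*} [AddCommGroup V] [Module ℝ V]
  [NormedAddCommGroup W] [NormedSpace ℝ W]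

theorem HasDirDeriv.hasDerivAt {g : V → W} {a v : V} {θ : ℝ} {w : W}
    (h : HasDirDeriv g (a + θ • v) v w) : HasDerivAt (fun τ : ℝ => g (a + τ • v)) w θ := by
  rw [hasDerivAt_iff_tendsto_slope_zero]
  refine h.congr fun t => ?_
  rw [add_smul, add_assoc]

/-- Mean value inequality for directional derivatives. -/
theorem norm_sub_sub_le_of_dirDeriv {g : V → W} {a v : V} {c : W} {η : ℝ}
    (hd : ∀ θ ∈ Icc (0 : ℝ) 1, DirDifferentiableAt g (a + θ • v) v)
    (hη : ∀ θ ∈ Icc (0 : ℝ) 1, ‖dirDeriv g (a + θ • v) v - c‖ ≤ η) :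
    ‖g (a + v) - g a - c‖ ≤ η := by
  have h1 : ∀ θ ∈ Icc (0 : ℝ) 1, HasDerivWithinAt (fun τ : ℝ => g (a + τ • v) - τ • c)
      (dirDeriv g (a + θ • v) v - c) (Icc 0 1) θ := fun θ hθ => by
    have := (hd θ hθ).hasDirDeriv.hasDerivAt.sub ((hasDerivAt_id θ).smul_const c)
    simp only [id, one_smul] at this
    exact this.hasDerivWithinAt
  have h2 := (convex_Icc (0 : ℝ) 1).norm_image_sub_le_of_norm_hasDerivWithin_le h1 hη
    (left_mem_Icc.2 zero_le_one) (right_mem_Icc.2 zero_le_one)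
  simp only [one_smul, zero_smul, add_zero, sub_zero, norm_one, mul_one] at h2
  rwa [sub_right_comm] at h2

end MeanValue

/-! ### Uniform estimates near compact sets -/

section Tube

variable {f : Hist n → EuclideanSpace ℝ (Fin n)} {U : Set (Hist n)}

/-- Uniform data near a set `K ⊆ U`: a history which is `r`-close on `[-R, 0]` to some element of
`K` belongs to `U`, and there the derivative of `f` is bounded by `L` with respect to the seminorm
`sup_{[-R, 0]} ‖v‖`. In particular, near `K` the function `f` depends only on the restrictions of
histories to `[-R, 0]`. -/
structure IsTube (f : Hist n → EuclideanSpace ℝ (Fin n)) (U K : Set (Hist n))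
    (R r L : ℝ) : Prop where
  R_pos : 0 < R
  r_pos : 0 < r
  L_pos : 0 < L
  mem : ∀ k ∈ K, histBall k R r ⊆ U
  bound : ∀ k ∈ K, ∀ u ∈ histBall k R r, ∀ (v : Hist n) (a : ℝ),
    (∀ s : Iic (0 : ℝ), -R ≤ (s : ℝ) → ‖v s‖ ≤ a) → ‖dirDeriv f u v‖ ≤ L * a

theorem IsTube.weaken {K K' : Set (Hist n)} {R r L R' r' L' : ℝ} (h : IsTube f U K R r L)
    (hK : K' ⊆ K) (hR : R ≤ R') (hr : r' ≤ r) (hr' : 0 < r') (hL : L ≤ L') :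
    IsTube f U K' R' r' L' := by
  have hsub : ∀ k : Hist n, histBall k R' r' ⊆ histBall k R r := fun k w hw s hs =>
    (hw s (by linarith)).trans_le hr
  refine ⟨h.R_pos.trans_le hR, hr', h.L_pos.trans_le hL,
    fun k hk => (hsub k).trans (h.mem k (hK hk)), fun k hk u hu v a hv => ?_⟩
  have h1 := h.bound k (hK hk) u (hsub k hu) v a fun s hs => hv s (by linarith)
  have ha : 0 ≤ a :=
    (norm_nonneg _).trans (hv ⟨0, mem_Iic.2 le_rfl⟩ (by simp; linarith [h.R_pos]))
  exact h1.trans (mul_le_mul_of_nonneg_right hL ha)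

theorem IsTube.union {K K' : Set (Hist n)} {R r L R' r' L' : ℝ} (h : IsTube f U K R r L)
    (h' : IsTube f U K' R' r' L') :
    IsTube f U (K ∪ K') (max R R') (min r r') (max L L') := by
  have h1 := h.weaken Subset.rfl (le_max_left R R') (min_le_left r r')
    (lt_min h.r_pos h'.r_pos) (le_max_left L L')
  have h2 := h'.weaken Subset.rfl (le_max_right R R') (min_le_right r r')
    (lt_min h.r_pos h'.r_pos) (le_max_right L L')
  exact ⟨h1.R_pos, h1.r_pos, h1.L_pos, fun k hk => hk.elim (h1.mem k) (h2.mem k),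
    fun k hk => hk.elim (h1.bound k) (h2.bound k)⟩

theorem dirDeriv_zero (u : Hist n) : dirDeriv f u 0 = 0 := by
  apply HasDirDeriv.dirDeriv_eq
  simp [HasDirDeriv]

/-- Joint continuity of `(u, v) ↦ Df(u)v` at `(u, 0)` makes the derivative small for `v` in a
neighbourhood of `0`, which involves only a compact interval `[-R, 0]`. -/
theorem exists_isTube_nhds (hU : IsOpen U) (hf : IsC1MB f U) {u : Hist n} (hu : u ∈ U) :
    ∃ S ∈ 𝓝 u, ∃ R r L, IsTube f U S R r L := by
  -- near `(u, 0)` the derivative is bounded by `1`; homogeneity turns this into an estimate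
  have h1 : ∀ᶠ p : Hist n × Hist n in 𝓝 (u, 0), p.1 ∈ U ∧ ‖dirDeriv f p.1 p.2‖ < 1 := by
    have hopen : U ×ˢ (univ : Set (Hist n)) ∈ 𝓝 ((u, 0) : Hist n × Hist n) :=
      (hU.prod isOpen_univ).mem_nhds ⟨hu, mem_univ _⟩
    have hc : ContinuousAt (fun p : Hist n × Hist n => ‖dirDeriv f p.1 p.2‖) (u, 0) :=
      (hf.2.2.continuousAt hopen).norm
    have := hc.eventually_lt_const (show ‖dirDeriv f u 0‖ < 1 by simp [dirDeriv_zero])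
    filter_upwards [this, hopen] with p hp hp'
    exact ⟨hp'.1, hp⟩
  rw [nhds_prod_eq] at h1
  obtain ⟨P, hP, Q, hQ, hPQ⟩ := eventually_prod_iff.1 h1
  obtain ⟨R₁, r₁, hR₁, hr₁, h₁⟩ := exists_histBall_subset hP
  obtain ⟨R₂, r₂, hR₂, hr₂, h₂⟩ := exists_histBall_subset hQ
  have hball : ∀ k ∈ histBall u (max R₁ R₂) (r₁ / 2), ∀ w ∈ histBall k (max R₁ R₂) (r₁ / 2),
      P w := by
    intro k hk w hw
    refine h₁ fun s hs => ?_
    have hs' : -max R₁ R₂ ≤ (s : ℝ) := (neg_le_neg (le_max_left _ _)).trans hs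
    calc ‖w s - u s‖ = ‖(w s - k s) + (k s - u s)‖ := by congr 1; abel
      _ ≤ _ := norm_add_le _ _
      _ < r₁ := by linarith [hk s hs', hw s hs']
  have hQ0 : Q 0 := h₂ fun s _ => by simpa using hr₂
  refine ⟨histBall u (max R₁ R₂) (r₁ / 2), histBall_mem_nhds _ _ (half_pos hr₁),
    max R₁ R₂, r₁ / 2, 2 / r₂, lt_max_of_lt_left hR₁, half_pos hr₁, by positivity,
    fun k hk w hw => (hPQ (hball k hk w hw) hQ0).1, fun k hk w hw v a hv => ?_⟩
  have ha : 0 ≤ a := (norm_nonneg _).trans (hv ⟨0, mem_Iic.2 le_rfl⟩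
    (by simp only [Left.neg_nonpos_iff]; exact hR₁.le.trans (le_max_left _ _)))
  have hw' : w ∈ U := (hPQ (hball k hk w hw) hQ0).1
  -- scale `v` to size at most `r₂ / 2 < r₂`, with `b` slightly larger than `a` since `a` may vanish
  refine le_of_forall_pos_le_add fun e he => ?_
  set b := a + e * (r₂ / 2) with hb
  have hb0 : 0 < b := by positivity
  set c := r₂ / 2 / b with hc
  have hc0 : 0 < c := by positivity
  have hcv : Q (c • v) := by
    refine h₂ fun s hs => ?_
    have := hv s ((neg_le_neg (le_max_right _ _)).trans hs)
    simp only [ContinuousMap.coe_smul, Pi.smul_apply, ContinuousMap.coe_zero, Pi.zero_apply,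
      sub_zero, norm_smul, Real.norm_eq_abs, abs_of_pos hc0]
    calc c * ‖v s‖ ≤ c * b := by
          gcongr
          exact this.trans (by rw [hb]; linarith [show 0 < e * (r₂ / 2) by positivity])
      _ = r₂ / 2 := by rw [hc]; field_simp
      _ < r₂ := by linarith
  have h3 := (hPQ (hball k hk w hw) hcv).2
  rw [(((hf.2.1 w hw' v).hasDirDeriv).const_smul hc0.ne').dirDeriv_eq, norm_smul,
    Real.norm_eq_abs, abs_of_pos hc0] at h3
  have h4 : ‖dirDeriv f w v‖ < 1 / c := by rwa [lt_div_iff₀ hc0, mul_comm]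
  refine h4.le.trans (le_of_eq ?_)
  rw [hc, hb]
  field_simp

theorem exists_isTube (hU : IsOpen U) (hf : IsC1MB f U) {K : Set (Hist n)} (hK : IsCompact K)
    (hKU : K ⊆ U) : ∃ R r L, IsTube f U K R r L := by
  refine hK.induction_on (p := fun S => ∃ R r L, IsTube f U S R r L) ?_ ?_ ?_ ?_
  · exact ⟨1, 1, 1, one_pos, one_pos, one_pos, by simp, by simp⟩
  · rintro S S' hS ⟨R, r, L, h⟩
    exact ⟨R, r, L, h.weaken hS le_rfl le_rfl h.r_pos le_rfl⟩
  · rintro S S' ⟨R, r, L, h⟩ ⟨R', r', L', h'⟩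
    exact ⟨_, _, _, h.union h'⟩
  · intro u hu
    obtain ⟨S, hS, h⟩ := exists_isTube_nhds hU hf (hKU hu)
    exact ⟨S, mem_nhdsWithin_of_mem_nhds hS, h⟩

theorem convex_histBall (k : Hist n) (R r : ℝ) : Convex ℝ (histBall k R r) := by
  intro u hu w hw a b ha hb hab s hs
  have h1 : (a • u + b • w) s - k s = a • (u s - k s) + b • (w s - k s) := by
    have : k s = (a + b) • k s := by rw [hab, one_smul]
    simp only [ContinuousMap.add_apply, ContinuousMap.smul_apply]
    nth_rewrite 1 [this]
    module
  rw [h1]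
  have h2 := convex_ball (0 : EuclideanSpace ℝ (Fin n)) r (mem_ball_zero_iff.2 (hu s hs))
    (mem_ball_zero_iff.2 (hw s hs)) ha hb hab
  exact mem_ball_zero_iff.1 h2

theorem self_mem_histBall (k : Hist n) (R : ℝ) {r : ℝ} (hr : 0 < r) : k ∈ histBall k R r :=
  fun s _ => by simpa using hr

variable {K : Set (Hist n)} {R r L : ℝ}

theorem IsTube.lipschitz (h : IsTube f U K R r L) (hf : IsC1MB f U) {k u w : Hist n}
    (hk : k ∈ K) (hu : u ∈ histBall k R r) (hw : w ∈ histBall k R r) {a : ℝ}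
    (ha : ∀ s : Iic (0 : ℝ), -R ≤ (s : ℝ) → ‖u s - w s‖ ≤ a) : ‖f u - f w‖ ≤ L * a := by
  have hmem : ∀ θ ∈ Icc (0 : ℝ) 1, w + θ • (u - w) ∈ histBall k R r := fun θ hθ =>
    (convex_histBall k R r).add_smul_sub_mem hw hu hθ
  have := norm_sub_sub_le_of_dirDeriv (g := f) (a := w) (v := u - w) (c := 0) (η := L * a)
    (fun θ hθ => hf.2.1 _ (h.mem k hk (hmem θ hθ)) _) (fun θ hθ => by
      rw [sub_zero]
      exact h.bound k hk _ (hmem θ hθ) _ a ha)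
  simpa using this

/-- The estimate for differences of `Df(k)` is obtained from the Lipschitz estimate for `f`, which
makes it unnecessary to know that `Df(k)` is additive. -/
theorem IsTube.dirDeriv_lipschitz (h : IsTube f U K R r L) (hf : IsC1MB f U) {k v w : Hist n}
    (hk : k ∈ K) {a : ℝ} (ha : ∀ s : Iic (0 : ℝ), -R ≤ (s : ℝ) → ‖v s - w s‖ ≤ a) :
    ‖dirDeriv f k v - dirDeriv f k w‖ ≤ L * a := by
  have hkU : k ∈ U := h.mem k hk (self_mem_histBall k R h.r_pos)
  have h1 := (hf.2.1 k hkU v).hasDirDeriv.sub (hf.2.1 k hkU w).hasDirDeriv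
  refine le_of_tendsto h1.norm ?_
  have hev : ∀ z : Hist n, ∀ᶠ t : ℝ in 𝓝[≠] 0, k + t • z ∈ histBall k R r := fun z => by
    have hc : Continuous fun t : ℝ => k + t • z := by fun_prop
    have : Tendsto (fun t : ℝ => k + t • z) (𝓝 0) (𝓝 k) := by
      have h0 : k + (0 : ℝ) • z = k := by ext1 s; simp
      have h1 := hc.tendsto 0
      rwa [h0] at h1
    exact (this.mono_left nhdsWithin_le_nhds) (histBall_mem_nhds k R h.r_pos)
  filter_upwards [hev v, hev w, self_mem_nhdsWithin] with t hv hw ht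
  have ht' : 0 < |t| := abs_pos.2 ht
  have h2 := h.lipschitz hf hk hv hw (a := |t| * a) fun s hs => by
    have : (k + t • v) s - (k + t • w) s = t • (v s - w s) := by
      simp only [ContinuousMap.add_apply, ContinuousMap.smul_apply]; module
    rw [this, norm_smul, Real.norm_eq_abs]
    exact mul_le_mul_of_nonneg_left (ha s hs) ht'.le
  rw [← smul_sub, sub_sub_sub_cancel_right, norm_smul, norm_inv, Real.norm_eq_abs,
    inv_mul_le_iff₀ ht']
  linarith

end Tube

/-! ### Retraction onto a ball -/

section Clip

variable {E : Type*} [NormedAddCommGroup E] [NormedSpace ℝ E]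

/-- The radial retraction of a normed space onto the closed ball of radius `r` around `0`. -/
noncomputable def clip (r : ℝ) (v : E) : E := (r / max r ‖v‖) • v

theorem clip_of_norm_le {r : ℝ} (hr : 0 < r) {v : E} (hv : ‖v‖ ≤ r) : clip r v = v := by
  rw [clip, max_eq_left hv, div_self hr.ne', one_smul]

theorem norm_clip_le {r : ℝ} (hr : 0 < r) (v : E) : ‖clip r v‖ ≤ r := by
  have hm : 0 < max r ‖v‖ := lt_max_of_lt_left hr
  rw [clip, norm_smul, Real.norm_eq_abs, abs_of_pos (div_pos hr hm), div_mul_eq_mul_div,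
    div_le_iff₀ hm]
  exact mul_le_mul_of_nonneg_left (le_max_right _ _) hr.le

theorem continuous_clip {r : ℝ} (hr : 0 < r) : Continuous (clip r : E → E) := by
  have : ∀ v : E, max r ‖v‖ ≠ 0 := fun v => (lt_max_of_lt_left hr).ne'
  unfold clip
  exact (continuous_const.div (by fun_prop) this).smul continuous_id

theorem norm_clip_sub_clip_le {r : ℝ} (hr : 0 < r) (v w : E) :
    ‖clip r v - clip r w‖ ≤ 2 * ‖v - w‖ := by
  set A := max r ‖v‖ with hA
  set B := max r ‖w‖ with hB
  have hA0 : 0 < A := lt_max_of_lt_left hr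
  have hB0 : 0 < B := lt_max_of_lt_left hr
  have hrA : r ≤ A := le_max_left _ _
  have hwB : ‖w‖ ≤ B := le_max_right _ _
  have hAB : |B - A| ≤ ‖v - w‖ := by
    refine (abs_max_sub_max_le_max r ‖w‖ r ‖v‖).trans ?_
    rw [sub_self, abs_zero]
    refine max_le (norm_nonneg _) ?_
    rw [norm_sub_rev]
    exact abs_norm_sub_norm_le w v
  have h1 : clip r v - clip r w = (r / A) • (v - w) + ((r / A) * ((B - A) / B)) • w := by
    have : r / A * ((B - A) / B) = r / A - r / B := by field_simp
    rw [this, clip, clip, ← hA, ← hB]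
    module
  have h2 : ‖(r / A) • (v - w)‖ ≤ ‖v - w‖ := by
    rw [norm_smul, Real.norm_eq_abs, abs_of_pos (div_pos hr hA0)]
    exact mul_le_of_le_one_left (norm_nonneg _) ((div_le_one hA0).2 hrA)
  have h3 : ‖((r / A) * ((B - A) / B)) • w‖ ≤ ‖v - w‖ := by
    rw [norm_smul, Real.norm_eq_abs, abs_mul, abs_div (B - A), abs_of_pos (div_pos hr hA0),
      abs_of_pos hB0]
    calc r / A * (|B - A| / B) * ‖w‖ = r / A * |B - A| * (‖w‖ / B) := by ring
      _ ≤ 1 * |B - A| * 1 := by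
          gcongr
          · exact (div_le_one hA0).2 hrA
          · exact (div_le_one hB0).2 hwB
      _ ≤ ‖v - w‖ := by linarith
  rw [h1]
  exact (norm_add_le _ _).trans (by linarith)

end Clip

/-! ### Gronwall's inequality for delay equations -/

/-- The proof estimates the maximum `N` of `t ↦ exp (-2 L t⁺) ‖z t‖` by `a + ε T + N / 2`. -/
theorem norm_le_of_norm_deriv_le_delay {E : Type*} [NormedAddCommGroup E] [NormedSpace ℝ E]
    {z z' : ℝ → E} (hz : Continuous z) {T L a ε R : ℝ} (hT : 0 ≤ T) (hL : 0 < L) (ha : 0 ≤ a)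
    (hε : 0 ≤ ε) (hR : 0 ≤ R) (h0 : ∀ s ∈ Icc (-R) 0, ‖z s‖ ≤ a)
    (hd : ∀ t ∈ Icc 0 T, HasDerivWithinAt z (z' t) (Icc 0 T) t)
    (hb : ∀ t ∈ Icc 0 T, ∀ b, (∀ s ∈ Icc (t - R) t, ‖z s‖ ≤ b) → ‖z' t‖ ≤ L * b + ε) :
    ∀ t ∈ Icc (-R) T, ‖z t‖ ≤ 2 * (a + ε * T) * Real.exp (2 * L * T) := by
  obtain ⟨m, hm, hmax⟩ := (isCompact_Icc (a := -R) (b := T)).exists_isMaxOn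
    ⟨0, by simpa using hR, hT⟩
    (f := fun t => Real.exp (-(2 * L * max t 0)) * ‖z t‖) (by fun_prop)
  set N := Real.exp (-(2 * L * max m 0)) * ‖z m‖ with hN
  have hN0 : 0 ≤ N := by positivity
  have hzN : ∀ t ∈ Icc (-R) T, ‖z t‖ ≤ N * Real.exp (2 * L * max t 0) := fun t ht => by
    have h1 : Real.exp (-(2 * L * max t 0)) * ‖z t‖ ≤ N := hmax ht
    rw [Real.exp_neg, inv_mul_le_iff₀ (Real.exp_pos _)] at h1
    linarith
  have hεT : 0 ≤ ε * T := mul_nonneg hε hT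
  have key : N ≤ 2 * (a + ε * T) := by
    rcases le_or_gt m 0 with hm0 | hm0
    · have h1 : N = ‖z m‖ := by rw [hN, max_eq_right hm0]; simp
      have := h0 m ⟨hm.1, hm0⟩
      linarith
    · have hB : ∀ t : ℝ, HasDerivAt (fun t => a + ε * t + N / 2 * Real.exp (2 * L * t))
          (ε + N / 2 * (Real.exp (2 * L * t) * (2 * L))) t := fun t => by
        have h1 : HasDerivAt (fun t : ℝ => ε * t) ε t := by
          simpa using (hasDerivAt_id t).const_mul ε
        have h2 : HasDerivAt (fun t : ℝ => 2 * L * t) (2 * L) t := by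
          simpa using (hasDerivAt_id t).const_mul (2 * L)
        exact (h1.const_add a).add (h2.exp.const_mul (N / 2))
      have h1 := image_norm_le_of_norm_deriv_right_le_deriv_boundary (f := z) (f' := z')
        (a := 0) (b := T) hz.continuousOn
        (fun t ht => (hd t ⟨ht.1, ht.2.le⟩).mono_of_mem_nhdsWithin
          (Icc_mem_nhdsGE_of_mem ht))
        (by
          have := h0 0 ⟨by simpa using hR, le_rfl⟩
          simp only [mul_zero, add_zero, Real.exp_zero, mul_one]
          linarith) hB
        (fun t ht => by
          have h2 := hb t ⟨ht.1, ht.2.le⟩ (N * Real.exp (2 * L * t)) fun s hs => by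
            refine (hzN s ⟨by linarith [hs.1, ht.1], hs.2.trans ht.2.le⟩).trans ?_
            have : max s 0 ≤ t := max_le hs.2 ht.1
            gcongr
          calc ‖z' t‖ ≤ _ := h2
            _ = _ := by ring) ⟨hm0.le, hm.2⟩
      rw [hN, max_eq_left hm0.le, Real.exp_neg, inv_mul_le_iff₀ (Real.exp_pos _)]
      have h3 : ε * m ≤ ε * T := mul_le_mul_of_nonneg_left hm.2 hε
      have h4 : 1 ≤ Real.exp (2 * L * m) := Real.one_le_exp (by positivity)
      have h5 : N = (Real.exp (2 * L * m))⁻¹ * ‖z m‖ := by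
        rw [hN, max_eq_left hm0.le, Real.exp_neg]
      have h6 : ‖z m‖ = Real.exp (2 * L * m) * N := by
        rw [h5]; field_simp
      have h7 : a + ε * m ≤ Real.exp (2 * L * m) * (a + ε * T) :=
        (by linarith : a + ε * m ≤ 1 * (a + ε * T)).trans
          (mul_le_mul_of_nonneg_right h4 (by positivity))
      linarith
  intro t ht
  refine (hzN t ht).trans (mul_le_mul key ?_ (Real.exp_pos _).le (by positivity))
  have : max t 0 ≤ T := max_le ht.2 hT
  gcongr

/-! ### Global existence under a global Lipschitz condition -/

/-- The Picard operator of the equation, in the unknown `w t = exp (-K t) (y t - φ 0)`, is a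
contraction on `C([0, T])` for large `K`. -/
theorem exists_solution_of_lipschitz
    {F : ℝ → Hist n → EuclideanSpace ℝ (Fin n)} {L : ℝ} (hL : 0 ≤ L)
    (hFc : ∀ y : ℝ → EuclideanSpace ℝ (Fin n), Continuous y → Continuous fun t => F t (seg y t))
    (hFL : ∀ t u w a, (∀ s, ‖u s - w s‖ ≤ a) → ‖F t u - F t w‖ ≤ L * a)
    (φ : Hist n) {T : ℝ} (hT : 0 ≤ T) :
    ∃ y : ℝ → EuclideanSpace ℝ (Fin n), Continuous y ∧ seg y 0 = φ ∧
      ∀ t ∈ Icc 0 T, HasDerivWithinAt y (F t (seg y t)) (Icc 0 T) t := by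
  set K : ℝ := 4 * L + 1 with hK
  have hK0 : 0 < K := by positivity
  -- the term `w 0` is subtracted to make `Y w` continuous at `0` for every `w`
  let Y : C(Icc (0 : ℝ) T, EuclideanSpace ℝ (Fin n)) → ℝ → EuclideanSpace ℝ (Fin n) :=
    fun w t => φ ⟨min t 0, mem_Iic.2 (min_le_right _ _)⟩ +
      (Real.exp (K * max t 0) • w (projIcc 0 T hT t) - w (projIcc 0 T hT 0))
  have hYc : ∀ w, Continuous (Y w) := fun w => by
    have h1 : Continuous fun t : ℝ => (⟨min t 0, mem_Iic.2 (min_le_right _ _)⟩ : Iic (0 : ℝ)) :=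
      Continuous.subtype_mk (by fun_prop) _
    have h2 : Continuous fun t : ℝ => w (projIcc 0 T hT t) :=
      w.continuous.comp continuous_projIcc
    have h3 : Continuous fun t : ℝ => Real.exp (K * max t 0) := by fun_prop
    exact (φ.continuous.comp h1).add ((h3.smul h2).sub continuous_const)
  have hint : ∀ w, Continuous fun t => F t (seg (Y w) t) := fun w => hFc _ (hYc w)
  have hIder : ∀ w t, HasDerivAt (fun t => ∫ s in (0 : ℝ)..t, F s (seg (Y w) s))
      (F t (seg (Y w) t)) t := fun w t => ((hint w).integral_hasStrictDerivAt 0 t).hasDerivAt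
  have hIc : ∀ w, Continuous fun t => ∫ s in (0 : ℝ)..t, F s (seg (Y w) s) := fun w =>
    continuous_iff_continuousAt.2 fun t => (hIder w t).continuousAt
  let P : C(Icc (0 : ℝ) T, EuclideanSpace ℝ (Fin n)) → C(Icc (0 : ℝ) T, EuclideanSpace ℝ (Fin n)) :=
    fun w => ⟨fun t => Real.exp (-(K * t)) • ∫ s in (0 : ℝ)..t, F s (seg (Y w) s), by
      have h1 : Continuous fun t : Icc (0 : ℝ) T => Real.exp (-(K * (t : ℝ))) := by fun_prop
      exact h1.smul ((hIc w).comp continuous_subtype_val)⟩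
  have hcontr : ContractingWith (1 / 2) P := by
    refine ⟨by norm_num, LipschitzWith.of_dist_le_mul fun w w' => ?_⟩
    set D := dist w w' with hD
    have hD0 : 0 ≤ D := dist_nonneg
    rw [ContinuousMap.dist_le (by positivity)]
    rintro ⟨t, ht⟩
    have hYY : ∀ s, ‖Y w s - Y w' s‖ ≤ 2 * Real.exp (K * max s 0) * D := fun s => by
      have h1 : Y w s - Y w' s = Real.exp (K * max s 0) •
          (w (projIcc 0 T hT s) - w' (projIcc 0 T hT s)) -
          (w (projIcc 0 T hT 0) - w' (projIcc 0 T hT 0)) := by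
        simp only [Y]; module
      have h2 : ∀ p, ‖w p - w' p‖ ≤ D := fun p => by
        rw [← dist_eq_norm]; exact ContinuousMap.dist_apply_le_dist p
      have h3 : 1 ≤ Real.exp (K * max s 0) := Real.one_le_exp (by positivity)
      rw [h1]
      refine (norm_sub_le _ _).trans ?_
      rw [norm_smul, Real.norm_eq_abs, abs_of_pos (Real.exp_pos _)]
      have h4 := mul_le_mul_of_nonneg_left (h2 (projIcc 0 T hT s)) (Real.exp_pos (K * max s 0)).le
      have h5 := h2 (projIcc 0 T hT 0)
      have h6 : 1 * D ≤ Real.exp (K * max s 0) * D := mul_le_mul_of_nonneg_right h3 hD0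
      linarith
    have hFF : ∀ s ∈ Ioc 0 t, ‖F s (seg (Y w) s) - F s (seg (Y w') s)‖
        ≤ L * (2 * D) * Real.exp (K * s) := fun s hs => by
      have h1 := hFL s (seg (Y w) s) (seg (Y w') s) (2 * Real.exp (K * s) * D) fun q => by
        rw [seg_apply (hYc w), seg_apply (hYc w')]
        refine (hYY _).trans ?_
        have : max (s + (q : ℝ)) 0 ≤ s :=
          max_le (by have := q.2; simp only [mem_Iic] at this; linarith) hs.1.le
        gcongr
      linarith
    have h1 := intervalIntegral.norm_integral_le_of_norm_le
      (μ := MeasureTheory.volume) ht.1 (Eventually.of_forall hFF)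
      ((by fun_prop : Continuous fun s => L * (2 * D) * Real.exp (K * s)).intervalIntegrable _ _)
    have h2 : ∫ s in (0 : ℝ)..t, L * (2 * D) * Real.exp (K * s)
        = L * (2 * D) * (K⁻¹ * (Real.exp (K * t) - 1)) := by
      rw [intervalIntegral.integral_const_mul,
        intervalIntegral.integral_comp_mul_left (fun s => Real.exp s) hK0.ne', integral_exp]
      simp
    have hLK : L * 2 * K⁻¹ ≤ 1 / 2 := by
      rw [← div_eq_mul_inv, div_le_iff₀ hK0]; linarith
    rw [dist_eq_norm]
    change ‖Real.exp (-(K * t)) • (∫ s in (0 : ℝ)..t, F s (seg (Y w) s)) -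
      Real.exp (-(K * t)) • (∫ s in (0 : ℝ)..t, F s (seg (Y w') s))‖ ≤ _
    rw [← smul_sub, ← intervalIntegral.integral_sub ((hint w).intervalIntegrable _ _)
      ((hint w').intervalIntegrable _ _), norm_smul, Real.norm_eq_abs,
      abs_of_pos (Real.exp_pos _), Real.exp_neg, inv_mul_le_iff₀ (Real.exp_pos _)]
    refine (h1.trans_eq h2).trans ?_
    calc L * (2 * D) * (K⁻¹ * (Real.exp (K * t) - 1))
        = (L * 2 * K⁻¹) * (D * (Real.exp (K * t) - 1)) := by ring
      _ ≤ 1 / 2 * (D * (Real.exp (K * t) - 1)) := by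
          have : 1 ≤ Real.exp (K * t) := Real.one_le_exp (mul_nonneg hK0.le ht.1)
          exact mul_le_mul_of_nonneg_right hLK (mul_nonneg hD0 (by linarith))
      _ ≤ Real.exp (K * t) * (((1 / 2 : NNReal) : ℝ) * D) := by
          push_cast
          linarith
  obtain ⟨w, hw⟩ : ∃ w, P w = w := ⟨_, hcontr.fixedPoint_isFixedPt⟩
  have hwt : ∀ t (ht : t ∈ Icc 0 T),
      Real.exp (-(K * t)) • ∫ s in (0 : ℝ)..t, F s (seg (Y w) s) = w ⟨t, ht⟩ := fun t ht =>
    DFunLike.congr_fun hw ⟨t, ht⟩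
  have hw0 : w (projIcc 0 T hT 0) = 0 := by
    rw [projIcc_of_mem hT ⟨le_rfl, hT⟩, ← hwt 0 ⟨le_rfl, hT⟩]
    simp
  refine ⟨Y w, hYc w, (seg_zero_eq_iff (hYc w).continuousOn).2 fun s => ?_, fun t ht => ?_⟩
  · have hs : (s : ℝ) ≤ 0 := s.2
    have h1 : projIcc 0 T hT (s : ℝ) = projIcc 0 T hT 0 := by
      rw [projIcc_of_le_left hT hs, projIcc_of_le_left hT le_rfl]
    have h2 : (⟨min (s : ℝ) 0, mem_Iic.2 (min_le_right _ _)⟩ : Iic (0 : ℝ)) = s :=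
      Subtype.ext (min_eq_left hs)
    simp only [Y]
    rw [h1, hw0, h2]
    simp
  · have hY : ∀ s ∈ Icc 0 T, Y w s = φ ⟨0, mem_Iic.2 le_rfl⟩ +
        ∫ q in (0 : ℝ)..s, F q (seg (Y w) q) := fun s hs => by
      have h2 : (⟨min (s : ℝ) 0, mem_Iic.2 (min_le_right _ _)⟩ : Iic (0 : ℝ)) =
          ⟨0, mem_Iic.2 le_rfl⟩ := Subtype.ext (min_eq_right hs.1)
      have h3 : Real.exp (K * s) • w ⟨s, hs⟩ = ∫ q in (0 : ℝ)..s, F q (seg (Y w) q) := by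
        rw [← hwt s hs, smul_smul, ← Real.exp_add]
        simp
      rw [← h3]
      change φ _ + (_ - _) = _
      rw [h2, hw0, projIcc_of_mem hT hs, max_eq_left hs.1, sub_zero]
    exact ((hIder w t).const_add _).hasDerivWithinAt.congr hY (hY t ht)

/-! ### Truncation of the right-hand side around a curve -/

/-- The pointwise retraction of a history onto the closed ball of radius `r`. -/
noncomputable def clipHist {r : ℝ} (hr : 0 < r) (u : Hist n) : Hist n :=
  ContinuousMap.comp ⟨clip r, continuous_clip hr⟩ u

/-- The function `f`, evaluated at `u` after `u` has been moved into the `r`-neighbourhood of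
`b t`. It is defined for all `u` and globally Lipschitz if `f` is Lipschitz near `b t`. -/
noncomputable def clippedField (f : Hist n → EuclideanSpace ℝ (Fin n)) {r : ℝ} (hr : 0 < r)
    (b : ℝ → Hist n) (t : ℝ) (u : Hist n) : EuclideanSpace ℝ (Fin n) :=
  f (b t + clipHist hr (u - b t))

section Field

variable {f : Hist n → EuclideanSpace ℝ (Fin n)} {U K : Set (Hist n)} {R r L ρ : ℝ}
  {b : ℝ → Hist n}

theorem add_clipHist_mem_histBall (hρ : 0 < ρ) (hρr : ρ < r) (k v : Hist n) :
    k + clipHist hρ v ∈ histBall k R r := fun s _ => by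
  have : (k + clipHist hρ v) s - k s = clip ρ (v s) := by simp [clipHist]
  rw [this]
  exact (norm_clip_le hρ _).trans_lt hρr

theorem IsTube.clippedField_eq (h : IsTube f U K R r L) (hf : IsC1MB f U) (hρ : 0 < ρ)
    (hρr : ρ < r) {t : ℝ} (hb : b t ∈ K) {u : Hist n}
    (hu : ∀ s : Iic (0 : ℝ), -R ≤ (s : ℝ) → ‖u s - b t s‖ ≤ ρ) :
    clippedField f hρ b t u = f u := by
  -- both arguments of `f` coincide on `[-R, 0]`
  rw [← sub_eq_zero, ← norm_le_zero_iff, ← mul_zero L]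
  refine h.lipschitz hf hb (add_clipHist_mem_histBall hρ hρr _ _)
    (fun s hs => (hu s hs).trans_lt hρr) fun s hs => ?_
  have : (b t + clipHist hρ (u - b t)) s = b t s + clip ρ (u s - b t s) := by simp [clipHist]
  rw [this, clip_of_norm_le hρ (hu s hs)]
  simp

theorem IsTube.clippedField_lipschitz (h : IsTube f U K R r L) (hf : IsC1MB f U) (hρ : 0 < ρ)
    (hρr : ρ < r) {t : ℝ} (hb : b t ∈ K) {u w : Hist n} {a : ℝ}
    (ha : ∀ s : Iic (0 : ℝ), -R ≤ (s : ℝ) → ‖u s - w s‖ ≤ a) :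
    ‖clippedField f hρ b t u - clippedField f hρ b t w‖ ≤ 2 * L * a := by
  have h1 := h.lipschitz hf hb (add_clipHist_mem_histBall hρ hρr (b t) (u - b t))
    (add_clipHist_mem_histBall hρ hρr (b t) (w - b t)) (a := 2 * a) fun s hs => by
    have : (b t + clipHist hρ (u - b t)) s - (b t + clipHist hρ (w - b t)) s =
        clip ρ (u s - b t s) - clip ρ (w s - b t s) := by simp [clipHist]
    rw [this]
    refine (norm_clip_sub_clip_le hρ _ _).trans ?_
    rw [sub_sub_sub_cancel_right]
    exact mul_le_mul_of_nonneg_left (ha s hs) zero_le_two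
  exact h1.trans_eq (by ring)

theorem IsTube.continuous_clippedField (h : IsTube f U K R r L) (hf : IsC1MB f U) (hρ : 0 < ρ)
    (hρr : ρ < r) (hb : ∀ t, b t ∈ K) (hbc : Continuous b) {c : ℝ → Hist n}
    (hc : Continuous c) : Continuous fun t => clippedField f hρ b t (c t) := by
  have h1 : Continuous (clipHist hρ : Hist n → Hist n) := ContinuousMap.continuous_postcomp _
  exact hf.1.comp_continuous (hbc.add (h1.comp (hc.sub hbc)))
    fun t => h.mem _ (hb t) (add_clipHist_mem_histBall hρ hρr _ _)

theorem IsTube.exists_clipped_solution (h : IsTube f U K R r L) (hf : IsC1MB f U) (hρ : 0 < ρ)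
    (hρr : ρ < r) (hb : ∀ t, b t ∈ K) (hbc : Continuous b) (φ : Hist n) {T : ℝ} (hT : 0 ≤ T) :
    ∃ y : ℝ → EuclideanSpace ℝ (Fin n), Continuous y ∧ seg y 0 = φ ∧
      ∀ t ∈ Icc 0 T, HasDerivWithinAt y (clippedField f hρ b t (seg y t)) (Icc 0 T) t :=
  exists_solution_of_lipschitz (mul_nonneg zero_le_two h.L_pos.le)
    (fun _ hy => h.continuous_clippedField hf hρ hρr hb hbc (continuous_seg hy))
    (fun t _ _ _ ha => h.clippedField_lipschitz hf hρ hρr (hb t) fun s _ => ha s) φ hT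

end Field

/-! ### Existence, uniqueness, and continuous dependence on initial data -/

section Solutions

variable {f : Hist n → EuclideanSpace ℝ (Fin n)} {U : Set (Hist n)}

/-- The equation truncated around the constant curve `φ` has a solution on `[0, 1]`, which solves
the original equation as long as its segments are close to `φ`. -/
theorem exists_isSolution (hU : IsOpen U) (hf : IsC1MB f U) {φ : Hist n} (hφ : φ ∈ U) :
    ∃ T > 0, ∃ y : ℝ → EuclideanSpace ℝ (Fin n), IsSolution f U y (Icc 0 T) ∧ seg y 0 = φ := by
  obtain ⟨R, r, L, h⟩ := exists_isTube hU hf (isCompact_singleton (x := φ))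
    (singleton_subset_iff.2 hφ)
  obtain ⟨y, hyc, hy0, hy⟩ := h.exists_clipped_solution hf (half_pos h.r_pos)
    (half_lt_self h.r_pos) (b := fun _ => φ) (fun _ => rfl) continuous_const φ zero_le_one
  have hev : ∀ᶠ t in 𝓝 (0 : ℝ), seg y t ∈ histBall φ R (r / 2) := by
    have := (continuous_seg hyc).tendsto 0
    rw [hy0] at this
    exact this (histBall_mem_nhds φ R (half_pos h.r_pos))
  obtain ⟨δ, hδ, hball⟩ := Metric.eventually_nhds_iff.1 hev
  have hmem : ∀ t ∈ Icc 0 (min (δ / 2) 1), seg y t ∈ histBall φ R (r / 2) := fun t ht => by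
    refine hball ?_
    rw [dist_zero_right, Real.norm_eq_abs, abs_of_nonneg ht.1]
    linarith [ht.2.trans (min_le_left _ _)]
  refine ⟨min (δ / 2) 1, by positivity, y, ⟨hyc.continuousOn, fun t ht => ⟨?_, ?_⟩⟩, hy0⟩
  · exact h.mem φ rfl fun s hs => (hmem t ht s hs).trans (half_lt_self h.r_pos)
  · have h1 := hy t ⟨ht.1, ht.2.trans (min_le_right _ _)⟩
    have h2 : clippedField f (half_pos h.r_pos) (fun _ => φ) t (seg y t) = f (seg y t) :=
      h.clippedField_eq hf (half_pos h.r_pos) (half_lt_self h.r_pos) (mem_singleton φ)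
        fun s hs => (hmem t ht s hs).le
    rw [h2] at h1
    exact h1.mono (Icc_subset_Icc_right (min_le_right _ _))

/-- The set of times at which the segments agree is closed, and it is open to the right by the
local Lipschitz estimate. -/
theorem seg_eq_of_continuous_isSolution (hU : IsOpen U) (hf : IsC1MB f U)
    {x y : ℝ → EuclideanSpace ℝ (Fin n)} {T : ℝ} (hxc : Continuous x) (hyc : Continuous y)
    (hx : IsSolution f U x (Icc 0 T)) (hy : IsSolution f U y (Icc 0 T))
    (h0 : seg x 0 = seg y 0) : ∀ t ∈ Icc 0 T, seg x t = seg y t := by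
  have hsx := continuous_seg hxc
  have hsy := continuous_seg hyc
  suffices Icc 0 T ⊆ {t | seg x t = seg y t} from this
  refine IsClosed.Icc_subset_of_forall_mem_nhdsWithin
    ((isClosed_eq hsx hsy).inter isClosed_Icc) h0 ?_
  rintro t ⟨ht, ht0, htT⟩
  replace ht : seg x t = seg y t := ht
  have hEq : ∀ s ≤ t, x s = y s := fun s hs => by
    have := DFunLike.congr_fun ht ⟨s - t, by simpa using hs⟩
    simpa [seg_apply hxc, seg_apply hyc] using this
  obtain ⟨R, r, L, h⟩ := exists_isTube hU hf (isCompact_singleton (x := seg x t))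
    (singleton_subset_iff.2 (hx.2 t ⟨ht0, htT.le⟩).1)
  have hev : ∀ᶠ s in 𝓝 t, seg x s ∈ histBall (seg x t) R r ∧
      seg y s ∈ histBall (seg x t) R r := by
    have hN := histBall_mem_nhds (seg x t) R h.r_pos
    have hN' := hN
    nth_rewrite 1 [ht] at hN'
    exact Filter.inter_mem (hsx.tendsto t hN) (hsy.tendsto t hN')
  obtain ⟨δ, hδ, hball⟩ := Metric.eventually_nhds_iff.1 hev
  -- Gronwall's inequality up to a time `S` slightly larger than `t`
  refine mem_nhdsWithin_of_mem_nhds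
    (mem_of_superset (Iio_mem_nhds (lt_min (lt_add_of_pos_right t hδ) htT)) fun S hS => ?_)
  replace hS := lt_min_iff.1 (mem_Iio.1 hS)
  rcases le_or_gt S t with hSt | hSt
  · exact seg_congr fun s hs => hEq s (le_trans hs hSt)
  have hS0 : 0 ≤ S := ht0.trans hSt.le
  have hz := norm_le_of_norm_deriv_le_delay (z := fun s => x s - y s)
    (z' := fun s => f (seg x s) - f (seg y s)) (hxc.sub hyc) hS0 h.L_pos le_rfl le_rfl
    h.R_pos.le (fun s hs => by simp [hEq s (hs.2.trans ht0)])
    (fun s hs => ((hx.2 s ⟨hs.1, hs.2.trans hS.2.le⟩).2.sub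
      (hy.2 s ⟨hs.1, hs.2.trans hS.2.le⟩).2).mono (Icc_subset_Icc_right hS.2.le))
    (fun s hs b hb => by
      rw [add_zero]
      rcases le_or_gt s t with hst | hst
      · have hb0 : 0 ≤ b := (norm_nonneg _).trans (hb s ⟨by linarith [h.R_pos], le_rfl⟩)
        rw [seg_congr fun q hq => hEq q (le_trans hq hst), sub_self, norm_zero]
        exact mul_nonneg h.L_pos.le hb0
      · have hs' : dist s t < δ := by
          rw [Real.dist_eq, abs_of_pos (sub_pos.2 hst)]
          linarith [hs.2, hS.1]
        refine h.lipschitz hf rfl (hball hs').1 (hball hs').2 fun q hq => ?_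
        rw [seg_apply hxc, seg_apply hyc]
        have hq0 : (q : ℝ) ≤ 0 := q.2
        exact hb _ ⟨by linarith, by linarith⟩)
  refine seg_congr fun s hs => ?_
  rcases le_or_gt s t with hst | hst
  · exact hEq s hst
  · have := hz s ⟨by linarith [h.R_pos], hs⟩
    simpa [sub_eq_zero] using this

theorem IsSolution.eqOn (hU : IsOpen U) (hf : IsC1MB f U)
    {x y : ℝ → EuclideanSpace ℝ (Fin n)} {T : ℝ} (hT : 0 ≤ T)
    (hx : IsSolution f U x (Icc 0 T)) (hy : IsSolution f U y (Icc 0 T))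
    (h0 : seg x 0 = seg y 0) : EqOn x y (Iic T) := by
  obtain ⟨x', hxc, hxx, hx'⟩ := hx.exists_continuous hT
  obtain ⟨y', hyc, hyy, hy'⟩ := hy.exists_continuous hT
  have h1 : seg x' 0 = seg y' 0 := by
    rw [seg_congr (hxx.mono (Iic_subset_Iic.2 hT)), seg_congr (hyy.mono (Iic_subset_Iic.2 hT)), h0]
  have h2 := seg_eq_of_continuous_isSolution hU hf hxc hyc hx' hy' h1 T ⟨hT, le_rfl⟩
  intro t ht
  have h3 := DFunLike.congr_fun h2 ⟨t - T, by simpa using ht⟩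
  simp only [seg_apply hxc, seg_apply hyc, add_sub_cancel] at h3
  rw [← hxx ht, ← hyy ht, h3]

theorem isCompact_image_seg {x : ℝ → EuclideanSpace ℝ (Fin n)} (hx : Continuous x) (T : ℝ) :
    IsCompact (seg x '' Icc 0 T) :=
  isCompact_Icc.image (continuous_seg hx)

/-- Segments at times clamped to `[0, T]`. -/
theorem exists_clamped_seg {x : ℝ → EuclideanSpace ℝ (Fin n)} (hx : Continuous x) {T : ℝ}
    (hT : 0 ≤ T) : ∃ b : ℝ → Hist n, Continuous b ∧ (∀ t, b t ∈ seg x '' Icc 0 T) ∧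
      ∀ t ∈ Icc 0 T, b t = seg x t := by
  refine ⟨fun t => seg x (max 0 (min t T)), (continuous_seg hx).comp (by fun_prop),
    fun t => mem_image_of_mem _ ⟨le_max_left _ _, max_le hT (min_le_right _ _)⟩, fun t ht => ?_⟩
  simp only [min_eq_left ht.2, max_eq_right ht.1]

/-- Solutions with initial data close to those of a given solution `x` on `[0, T]` exist on
`[0, T]` and stay close to `x`. -/
theorem IsTube.exists_solution_near (hf : IsC1MB f U) {x : ℝ → EuclideanSpace ℝ (Fin n)}
    {T R r L : ℝ} (hT : 0 ≤ T) (hxc : Continuous x) (hx : IsSolution f U x (Icc 0 T))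
    (h : IsTube f U (seg x '' Icc 0 T) R r L) :
    ∃ δ > 0, ∀ φ ∈ histBall (seg x 0) R δ, ∃ y : ℝ → EuclideanSpace ℝ (Fin n),
      Continuous y ∧ seg y 0 = φ ∧ IsSolution f U y (Icc 0 T) ∧
      ∀ t ∈ Icc 0 T, seg y t ∈ histBall (seg x t) R r := by
  have hρ := half_pos h.r_pos
  have hρr := half_lt_self h.r_pos
  set δ := r / 2 / (2 * Real.exp (2 * (2 * L) * T)) with hδ
  refine ⟨δ, by positivity, fun φ hφ => ?_⟩
  obtain ⟨b, hbc, hbK, hbt⟩ := exists_clamped_seg hxc hT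
  obtain ⟨y, hyc, hy0, hy⟩ := h.exists_clipped_solution hf hρ hρr hbK hbc φ hT
  have hxF : ∀ t ∈ Icc 0 T, clippedField f hρ b t (seg x t) = f (seg x t) := fun t ht =>
    h.clippedField_eq hf hρ hρr (hbK t) fun s _ => by
      rw [hbt t ht, sub_self, norm_zero]; exact hρ.le
  have hyx : ∀ t ∈ Icc (-R) T, ‖y t - x t‖ ≤ r / 2 := fun t ht => by
    have h1 := norm_le_of_norm_deriv_le_delay (z := fun s => y s - x s)
      (z' := fun s => clippedField f hρ b s (seg y s) - clippedField f hρ b s (seg x s))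
      (hyc.sub hxc) hT (L := 2 * L) (mul_pos two_pos h.L_pos) (a := δ) (by positivity)
      le_rfl h.R_pos.le
      (fun s hs => by
        have h2 := hφ ⟨s, hs.2⟩ hs.1
        rw [← hy0, seg_apply hyc, seg_apply hxc, zero_add] at h2
        exact h2.le)
      (fun s hs => by
        have h2 := (hx.2 s hs).2
        rw [← hxF s hs] at h2
        exact (hy s hs).sub h2)
      (fun s hs c hc => by
        rw [add_zero]
        refine h.clippedField_lipschitz hf hρ hρr (hbK s) fun q hq => ?_
        rw [seg_apply hyc, seg_apply hxc]
        have hq0 : (q : ℝ) ≤ 0 := q.2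
        exact hc _ ⟨by linarith, by linarith⟩) t ht
    refine h1.trans_eq ?_
    rw [hδ]
    field_simp
    ring
  have hyx' : ∀ t ∈ Icc 0 T, ∀ s : Iic (0 : ℝ), -R ≤ (s : ℝ) →
      ‖seg y t s - seg x t s‖ ≤ r / 2 := fun t ht s hs => by
    rw [seg_apply hyc, seg_apply hxc]
    have hs0 : (s : ℝ) ≤ 0 := s.2
    exact hyx _ ⟨by linarith [ht.1], by linarith [ht.2]⟩
  have hmem : ∀ t ∈ Icc 0 T, seg y t ∈ histBall (seg x t) R r := fun t ht s hs =>
    (hyx' t ht s hs).trans_lt hρr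
  refine ⟨y, hyc, hy0, ⟨hyc.continuousOn, fun t ht => ⟨?_, ?_⟩⟩, hmem⟩
  · exact h.mem _ (mem_image_of_mem _ ht) (hmem t ht)
  · have h1 := hy t ht
    rwa [h.clippedField_eq hf hρ hρr (hbK t) (by rw [hbt t ht]; exact hyx' t ht)] at h1

end Solutions

/-! ### Differentiation with respect to initial data -/

section Variation

variable {f : Hist n → EuclideanSpace ℝ (Fin n)} {U : Set (Hist n)}
  {x : ℝ → EuclideanSpace ℝ (Fin n)} {T R r L : ℝ}

theorem IsTube.exists_variational_solution (hf : IsC1MB f U) (hT : 0 ≤ T) (hxc : Continuous x)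
    (h : IsTube f U (seg x '' Icc 0 T) R r L) (χ : Hist n) :
    ∃ v : ℝ → EuclideanSpace ℝ (Fin n), Continuous v ∧ seg v 0 = χ ∧
      ∀ t ∈ Icc 0 T, HasDerivWithinAt v (dirDeriv f (seg x t) (seg v t)) (Icc 0 T) t := by
  obtain ⟨b, hbc, hbK, hbt⟩ := exists_clamped_seg hxc hT
  have hbU : ∀ t, b t ∈ U := fun t => h.mem (b t) (hbK t) (self_mem_histBall (b t) R h.r_pos)
  have hFc : ∀ y : ℝ → EuclideanSpace ℝ (Fin n), Continuous y →
      Continuous fun t => dirDeriv f (b t) (seg y t) := fun y hy => by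
    exact ContinuousOn.comp_continuous (g := fun p : Hist n × Hist n => dirDeriv f p.1 p.2)
      (f := fun t => (b t, seg y t)) hf.2.2 (hbc.prodMk (continuous_seg hy))
      fun t => mk_mem_prod (hbU t) (mem_univ _)
  have hFL : ∀ (t : ℝ) (u w : Hist n) (a : ℝ), (∀ s, ‖u s - w s‖ ≤ a) →
      ‖dirDeriv f (b t) u - dirDeriv f (b t) w‖ ≤ L * a := fun t u w a ha =>
    h.dirDeriv_lipschitz hf (hbK t) fun s _ => ha s
  obtain ⟨v, hvc, hv0, hv⟩ := exists_solution_of_lipschitz (F := fun t => dirDeriv f (b t))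
    h.L_pos.le hFc hFL χ hT
  exact ⟨v, hvc, hv0, fun t ht => hbt t ht ▸ hv t ht⟩

/-- The first order Taylor estimate of `f`, uniformly along a curve of base points and
directions. -/
theorem eventually_norm_taylor_le (hU : IsOpen U) (hf : IsC1MB f U) {u w : ℝ → Hist n}
    (hu : Continuous u) (hw : Continuous w) (huU : ∀ t ∈ Icc 0 T, u t ∈ U) {η : ℝ} (hη : 0 < η) :
    ∀ᶠ τ in 𝓝 (0 : ℝ), ∀ t ∈ Icc 0 T,
      ‖f (u t + τ • w t) - f (u t) - τ • dirDeriv f (u t) (w t)‖ ≤ |τ| * η := by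
  have h1 : ∀ᶠ τ in 𝓝 (0 : ℝ), ∀ t ∈ Icc 0 T, u t + τ • w t ∈ U ∧
      ‖dirDeriv f (u t + τ • w t) (w t) - dirDeriv f (u t) (w t)‖ < η := by
    refine isCompact_Icc.eventually_forall_of_forall_eventually fun t ht => ?_
    have h0 : u t + (0 : ℝ) • w t = u t := by ext1 s; simp
    have hut := huU t ht
    have hc1 : Continuous fun p : ℝ × ℝ => u p.2 + p.1 • w p.2 := by fun_prop
    have hA : ∀ q : Hist n × Hist n, q.1 ∈ U →
        ContinuousAt (fun p : Hist n × Hist n => dirDeriv f p.1 p.2) q := fun q hq =>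
      hf.2.2.continuousAt ((hU.prod isOpen_univ).mem_nhds ⟨hq, mem_univ _⟩)
    have hc2 : ContinuousAt (fun p : ℝ × ℝ => dirDeriv f (u p.2 + p.1 • w p.2) (w p.2))
        ((0 : ℝ), t) :=
      ContinuousAt.comp (f := fun p : ℝ × ℝ => (u p.2 + p.1 • w p.2, w p.2))
        (g := fun p : Hist n × Hist n => dirDeriv f p.1 p.2)
        (hA _ (by simpa only [h0] using hut))
        (hc1.prodMk (hw.comp continuous_snd)).continuousAt
    have hc3 : ContinuousAt (fun p : ℝ × ℝ => dirDeriv f (u p.2) (w p.2)) ((0 : ℝ), t) :=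
      ContinuousAt.comp (f := fun p : ℝ × ℝ => (u p.2, w p.2))
        (g := fun p : Hist n × Hist n => dirDeriv f p.1 p.2) (hA _ hut)
        ((hu.comp continuous_snd).prodMk (hw.comp continuous_snd)).continuousAt
    have hlt : ‖dirDeriv f (u t + (0 : ℝ) • w t) (w t) - dirDeriv f (u t) (w t)‖ < η := by
      rw [h0, sub_self, norm_zero]; exact hη
    exact (hc1.continuousAt.eventually_mem
      (hU.mem_nhds (by simpa only [h0] using hut))).and
      ((hc2.sub hc3).norm.eventually_lt_const hlt)
  obtain ⟨δ, hδ, hball⟩ := Metric.eventually_nhds_iff.1 h1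
  refine Metric.eventually_nhds_iff.2 ⟨δ, hδ, fun τ hτ t ht => ?_⟩
  rcases eq_or_ne τ 0 with rfl | hτ0
  · have h0 : u t + (0 : ℝ) • w t = u t := by ext1 s; simp
    simp [h0]
  have hθ : ∀ θ ∈ Icc (0 : ℝ) 1, u t + (θ * τ) • w t ∈ U ∧
      ‖dirDeriv f (u t + (θ * τ) • w t) (w t) - dirDeriv f (u t) (w t)‖ < η := fun θ hθ => by
    refine hball ?_ t ht
    rw [dist_zero_right, norm_mul, Real.norm_eq_abs, abs_of_nonneg hθ.1]
    rw [dist_zero_right] at hτ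
    exact (mul_le_of_le_one_left (norm_nonneg _) hθ.2).trans_lt hτ
  refine norm_sub_sub_le_of_dirDeriv (fun θ h => ?_) fun θ h => ?_
  · rw [smul_smul]
    exact hf.2.1 _ (hθ θ h).1 _
  · rw [smul_smul,
      ((hf.2.1 _ (hθ θ h).1 (w t)).hasDirDeriv.const_smul hτ0).dirDeriv_eq, ← smul_sub, norm_smul,
      Real.norm_eq_abs]
    exact mul_le_mul_of_nonneg_left (hθ θ h).2.le (abs_nonneg _)

/-- With `v` a solution of the variational equation, `x + τ v` solves the equation up to an
error `o(τ)`; by Gronwall's inequality it differs by `o(τ)` from the solution with the same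
initial data. -/
theorem exists_variational_solution_tendsto (hU : IsOpen U) (hf : IsC1MB f U) (hT : 0 ≤ T)
    (hxc : Continuous x) (hx : IsSolution f U x (Icc 0 T)) (χ : Hist n) :
    ∃ v : ℝ → EuclideanSpace ℝ (Fin n), Continuous v ∧ seg v 0 = χ ∧
      (∀ t ∈ Icc 0 T, HasDerivWithinAt v (dirDeriv f (seg x t) (seg v t)) (Icc 0 T) t) ∧
      ∀ ε > 0, ∀ᶠ τ in 𝓝[≠] (0 : ℝ), ∃ y : ℝ → EuclideanSpace ℝ (Fin n), Continuous y ∧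
        IsSolution f U y (Icc 0 T) ∧ seg y 0 = seg x 0 + τ • χ ∧
        ∀ s ≤ T, ‖τ⁻¹ • (y s - x s) - v s‖ ≤ ε := by
  have hxU : ∀ t ∈ Icc 0 T, seg x t ∈ U := fun t ht => (hx.2 t ht).1
  obtain ⟨R, r, L, h⟩ := exists_isTube hU hf (isCompact_image_seg hxc T)
    (image_subset_iff.2 hxU)
  obtain ⟨v, hvc, hv0, hv⟩ := h.exists_variational_solution hf hT hxc χ
  obtain ⟨δ, hδ, hnear⟩ := h.exists_solution_near hf hT hxc hx
  refine ⟨v, hvc, hv0, hv, fun ε hε => ?_⟩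
  set η := ε / (2 * (T + 1) * Real.exp (2 * L * T)) with hη
  have hη0 : 0 < η := by positivity
  obtain ⟨M, hM⟩ := (isCompact_Icc (a := -R) (b := T)).exists_bound_of_continuousOn
    hvc.continuousOn
  have hM0 : 0 ≤ M := (norm_nonneg _).trans (hM 0 ⟨by linarith [h.R_pos], hT⟩)
  have hinit : ∀ᶠ τ in 𝓝 (0 : ℝ), seg x 0 + τ • χ ∈ histBall (seg x 0) R δ := by
    have hc : Continuous fun τ : ℝ => seg x 0 + τ • χ := by fun_prop
    have h0 : seg x 0 + (0 : ℝ) • χ = seg x 0 := by ext1 s; simp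
    have h1 := hc.tendsto 0
    rw [h0] at h1
    exact h1 (histBall_mem_nhds _ R hδ)
  have hsmall : ∀ᶠ τ in 𝓝 (0 : ℝ), |τ| * M < r := by
    have hc : Continuous fun τ : ℝ => |τ| * M := by fun_prop
    exact (hc.tendsto 0).eventually_lt_const (by simpa using h.r_pos)
  filter_upwards [nhdsWithin_le_nhds hinit, nhdsWithin_le_nhds hsmall, self_mem_nhdsWithin,
    nhdsWithin_le_nhds (eventually_norm_taylor_le hU hf (continuous_seg hxc)
      (continuous_seg hvc) hxU hη0)] with τ hτ1 hτ2 hτ0 hτ3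
  have hτpos : 0 < |τ| := abs_pos.2 hτ0
  obtain ⟨y, hyc, hy0, hy, hyb⟩ := hnear _ hτ1
  refine ⟨y, hyc, hy, hy0, fun s hs => ?_⟩
  have hneg : ∀ s ≤ (0 : ℝ), y s - x s - τ • v s = 0 := fun s hs => by
    have h1 := DFunLike.congr_fun hy0 ⟨s, hs⟩
    rw [← hv0] at h1
    simp only [ContinuousMap.add_apply, ContinuousMap.smul_apply, seg_apply hyc, seg_apply hxc,
      seg_apply hvc, zero_add] at h1
    rw [h1]
    abel
  have hz := norm_le_of_norm_deriv_le_delay (z := fun s => y s - x s - τ • v s)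
    (z' := fun s => f (seg y s) - f (seg x s) - τ • dirDeriv f (seg x s) (seg v s))
    ((hyc.sub hxc).sub (hvc.const_smul τ)) hT h.L_pos le_rfl (ε := |τ| * η) (by positivity)
    h.R_pos.le (fun s hs => by simp [hneg s hs.2])
    (fun s hs => ((hy.2 s hs).2.sub (hx.2 s hs).2).sub ((hv s hs).const_smul τ))
    (fun s hs c hc => by
      have hxv : seg x s + τ • seg v s ∈ histBall (seg x s) R r := fun q hq => by
        have h1 : (seg x s + τ • seg v s) q - seg x s q = τ • v (s + q) := by
          simp [seg_apply hvc]
        have hq0 : (q : ℝ) ≤ 0 := q.2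
        rw [h1, norm_smul, Real.norm_eq_abs]
        exact (mul_le_mul_of_nonneg_left
          (hM _ ⟨by linarith [hs.1], by linarith [hs.2]⟩) hτpos.le).trans_lt hτ2
      have h2 := h.lipschitz hf (mem_image_of_mem _ hs) (hyb s hs) hxv (a := c) fun q hq => by
        have hq0 : (q : ℝ) ≤ 0 := q.2
        have h1 : seg y s q - (seg x s + τ • seg v s) q =
            y (s + q) - x (s + q) - τ • v (s + q) := by
          simp only [ContinuousMap.add_apply, ContinuousMap.smul_apply, seg_apply hyc,
            seg_apply hxc, seg_apply hvc]
          abel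
        rw [h1]
        exact hc _ ⟨by linarith, by linarith⟩
      calc ‖f (seg y s) - f (seg x s) - τ • dirDeriv f (seg x s) (seg v s)‖
          = ‖(f (seg y s) - f (seg x s + τ • seg v s)) + (f (seg x s + τ • seg v s) -
              f (seg x s) - τ • dirDeriv f (seg x s) (seg v s))‖ := by congr 1; abel
        _ ≤ L * c + |τ| * η := (norm_add_le _ _).trans (add_le_add h2 (hτ3 s hs)))
  have hfin : ‖y s - x s - τ • v s‖ ≤ |τ| * ε := by
    rcases le_or_gt s 0 with hs0 | hs0
    · rw [hneg s hs0, norm_zero]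
      positivity
    · refine (hz s ⟨by linarith [h.R_pos], hs⟩).trans ?_
      have h1 : ε = η * (2 * (T + 1) * Real.exp (2 * L * T)) := by
        rw [hη]; field_simp
      have h2 : 0 ≤ |τ| * η * (2 * Real.exp (2 * L * T)) := by positivity
      rw [h1]
      linarith
  have h1 : τ⁻¹ • (y s - x s) - v s = τ⁻¹ • (y s - x s - τ • v s) := by
    rw [smul_sub τ⁻¹ (y s - x s), smul_smul, inv_mul_cancel₀ hτ0, one_smul]
  rw [h1, norm_smul, norm_inv, Real.norm_eq_abs, inv_mul_le_iff₀ hτpos]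
  exact hfin

end Variation

/-! ### Maximal solutions and solution operators -/

section Maximal

variable {f : Hist n → EuclideanSpace ℝ (Fin n)} {U : Set (Hist n)} {φ : Hist n}

theorem le_tmax {x : ℝ → EuclideanSpace ℝ (Fin n)} {T : ℝ} (hT : 0 < T)
    (hx : IsSolution f U x (Icc 0 T)) (h0 : seg x 0 = φ) : (T : EReal) ≤ tmax f U φ :=
  le_sSup ⟨T, rfl, hT, x, hx, h0⟩

theorem maxSol_eqOn (hU : IsOpen U) (hf : IsC1MB f U) {x : ℝ → EuclideanSpace ℝ (Fin n)} {T : ℝ}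
    (hT : 0 < T) (hx : IsSolution f U x (Icc 0 T)) (h0 : seg x 0 = φ) :
    EqOn (maxSol f U φ) x (Iio T) := by
  intro t ht
  replace ht : t < T := ht
  rcases le_or_gt t 0 with ht0 | ht0
  · rw [maxSol, dif_pos ht0]
    exact ((seg_zero_eq_iff ((hx.continuousOn_Iic hT.le).mono (Iic_subset_Iic.2 hT.le))).1 h0
      ⟨t, ht0⟩).symm
  · rw [maxSol, dif_neg ht0.not_ge]
    have hex : ∃ y : EuclideanSpace ℝ (Fin n), ∃ t' : ℝ, t < t' ∧ (t' : EReal) < tmax f U φ ∧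
        ∃ x : ℝ → EuclideanSpace ℝ (Fin n),
          IsSolution f U x (Icc 0 t') ∧ seg x 0 = φ ∧ y = x t := by
      refine ⟨x t, (t + T) / 2, by linarith, ?_, x, hx.mono (by linarith) (by linarith), h0, rfl⟩
      exact (EReal.coe_lt_coe_iff.2 (by linarith : (t + T) / 2 < T)).trans_le (le_tmax hT hx h0)
    obtain ⟨t', htt', -, z, hz, hz0, hzt⟩ := Classical.epsilon_spec hex
    rw [hzt]
    have hm : t ≤ min t' T := le_min htt'.le ht.le
    have hm0 : 0 ≤ min t' T := ht0.le.trans hm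
    exact (hz.mono hm0 (min_le_left _ _)).eqOn hU hf hm0 (hx.mono hm0 (min_le_right _ _))
      (hz0.trans h0.symm) hm

theorem exists_solution_of_lt_tmax {t : ℝ} (ht : (t : EReal) < tmax f U φ) :
    ∃ T, t < T ∧ 0 < T ∧ ∃ x : ℝ → EuclideanSpace ℝ (Fin n), Continuous x ∧
      IsSolution f U x (Icc 0 T) ∧ seg x 0 = φ := by
  obtain ⟨_, ⟨T, rfl, hT, x, hx, h0⟩, htT⟩ := lt_sSup_iff.1 ht
  obtain ⟨y, hyc, hyx, hy⟩ := hx.exists_continuous hT.le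
  exact ⟨T, EReal.coe_lt_coe_iff.1 htT, hT, y, hyc, hy,
    (seg_congr (hyx.mono (Iic_subset_Iic.2 hT.le))).trans h0⟩

theorem tmax_pos (hU : IsOpen U) (hf : IsC1MB f U) (hφ : φ ∈ U) : 0 < tmax f U φ := by
  obtain ⟨T, hT, x, hx, h0⟩ := exists_isSolution hU hf hφ
  exact (EReal.coe_pos.2 hT).trans_le (le_tmax hT hx h0)

theorem continuousOn_of_eqOn_Iio {g : ℝ → EuclideanSpace ℝ (Fin n)} {b : EReal}
    (h : ∀ t : ℝ, (t : EReal) < b → ∃ T, t < T ∧ ∃ x : ℝ → EuclideanSpace ℝ (Fin n),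
      Continuous x ∧ EqOn g x (Iio T)) : ContinuousOn g {t : ℝ | (t : EReal) < b} := by
  intro t ht
  obtain ⟨T, htT, x, hx, hgx⟩ := h t ht
  exact (hx.continuousAt.congr
    (hgx.eventuallyEq_of_mem (Iio_mem_nhds htT)).symm).continuousWithinAt

theorem hasDerivWithinAt_lifespan {g x : ℝ → EuclideanSpace ℝ (Fin n)} {t T : ℝ}
    {d : EuclideanSpace ℝ (Fin n)} (htT : t < T)
    (hgx : EqOn g x (Iio T)) (hx : HasDerivWithinAt x d (Icc 0 T) t) :
    HasDerivWithinAt g d (lifespan f U φ) t := by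
  have h1 : Icc 0 T ∈ 𝓝[lifespan f U φ] t :=
    mem_nhdsWithin.2 ⟨Iio T, isOpen_Iio, htT, fun s hs => ⟨hs.2.1, le_of_lt hs.1⟩⟩
  exact (hx.mono_of_mem_nhdsWithin h1).congr_of_eventuallyEq
    (hgx.eventuallyEq_of_mem (mem_nhdsWithin_of_mem_nhds (Iio_mem_nhds htT))) (hgx htT)

theorem isSolution_maxSol (hU : IsOpen U) (hf : IsC1MB f U) :
    IsSolution f U (maxSol f U φ) (lifespan f U φ) := by
  refine ⟨(continuousOn_of_eqOn_Iio (b := tmax f U φ) fun t ht => ?_).mono ?_, fun t ht => ?_⟩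
  · obtain ⟨T, htT, hT, x, hxc, hx, h0⟩ := exists_solution_of_lt_tmax ht
    exact ⟨T, htT, x, hxc, maxSol_eqOn hU hf hT hx h0⟩
  · rintro _ ⟨a, ha, b, hb, rfl⟩
    refine lt_of_le_of_lt (EReal.coe_le_coe_iff.2 ?_) hb.2
    simp only [mem_Iic] at ha
    linarith
  · obtain ⟨T, htT, hT, x, hxc, hx, h0⟩ := exists_solution_of_lt_tmax ht.2
    have hE := maxSol_eqOn hU hf hT hx h0
    rw [seg_congr (hE.mono (Iic_subset_Iio.2 htT))]
    have h1 := hx.2 t ⟨ht.1, htT.le⟩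
    exact ⟨h1.1, hasDerivWithinAt_lifespan htT hE h1.2⟩

theorem isOpen_solDomain (hU : IsOpen U) (hf : IsC1MB f U) (t : ℝ) :
    IsOpen (solDomain f U t) := by
  refine isOpen_iff_mem_nhds.2 fun φ hφ => ?_
  obtain ⟨T, htT, hT, x, hxc, hx, h0⟩ := exists_solution_of_lt_tmax hφ.2
  obtain ⟨R, r, L, h⟩ := exists_isTube hU hf (isCompact_image_seg hxc T)
    (image_subset_iff.2 fun s hs => (hx.2 s hs).1)
  obtain ⟨δ, hδ, hnear⟩ := h.exists_solution_near hf hT.le hxc hx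
  rw [h0] at hnear
  filter_upwards [hU.mem_nhds hφ.1, histBall_mem_nhds φ R hδ] with χ hχ hχ'
  obtain ⟨y, -, hy0, hy, -⟩ := hnear χ hχ'
  exact ⟨hχ, (EReal.coe_lt_coe_iff.2 htT).trans_le (le_tmax hT hy hy0)⟩

/-- For every `T < t_φ` there is a solution `v` of the variational equation on `[0, T]` whose
segments are the derivatives of the solution operators. -/
theorem exists_hasDirDeriv_solOp (hU : IsOpen U) (hf : IsC1MB f U) (χ : Hist n) {t : ℝ}
    (ht : (t : EReal) < tmax f U φ) :
    ∃ T, t < T ∧ 0 < T ∧ ∃ v : ℝ → EuclideanSpace ℝ (Fin n), Continuous v ∧ seg v 0 = χ ∧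
      (∀ s ∈ Icc 0 T, s < T →
        HasDerivWithinAt v (dirDeriv f (seg (maxSol f U φ) s) (seg v s)) (Icc 0 T) s) ∧
      ∀ s < T, HasDirDeriv (solOp f U s) φ χ (seg v s) := by
  obtain ⟨T, htT, hT, x, hxc, hx, h0⟩ := exists_solution_of_lt_tmax ht
  obtain ⟨v, hvc, hv0, hv, hlim⟩ := exists_variational_solution_tendsto hU hf hT.le hxc hx χ
  have hseg : ∀ s < T, seg (maxSol f U φ) s = seg x s := fun s hs =>
    seg_congr ((maxSol_eqOn hU hf hT hx h0).mono (Iic_subset_Iio.2 hs))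
  refine ⟨T, htT, hT, v, hvc, hv0, fun s hs hsT => by rw [hseg s hsT]; exact hv s hs,
    fun s hs => ?_⟩
  intro N hN
  obtain ⟨R, r, hR, hr, hball⟩ := exists_histBall_subset hN
  rw [mem_map]
  filter_upwards [hlim (r / 2) (half_pos hr)] with τ hτ
  obtain ⟨y, hyc, hy, hy0, hyv⟩ := hτ
  rw [h0] at hy0
  refine hball fun q _ => ?_
  have hq : (q : ℝ) ≤ 0 := q.2
  have h1 : solOp f U s (φ + τ • χ) = seg y s :=
    seg_congr ((maxSol_eqOn hU hf hT hy hy0).mono (Iic_subset_Iio.2 hs))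
  have h2 : solOp f U s φ = seg x s := hseg s hs
  have h3 : (τ⁻¹ • (seg y s - seg x s)) q - seg v s q =
      τ⁻¹ • (y (s + q) - x (s + q)) - v (s + q) := by
    simp [seg_apply hyc, seg_apply hxc, seg_apply hvc]
  change ‖(τ⁻¹ • (solOp f U s (φ + τ • χ) - solOp f U s φ)) q - seg v s q‖ < r
  rw [h1, h2, h3]
  exact (hyv _ (by linarith)).trans_lt (half_lt_self hr)

/-- The function `linSol` coincides locally with a solution of the variational equation. -/
theorem exists_linSol_eqOn (hU : IsOpen U) (hf : IsC1MB f U) (ψ : Hist n) {t : ℝ}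
    (ht : (t : EReal) < tmax f U φ) :
    ∃ T, t < T ∧ 0 < T ∧ ∃ v : ℝ → EuclideanSpace ℝ (Fin n), Continuous v ∧ seg v 0 = ψ ∧
      (∀ s ∈ Icc 0 T, s < T →
        HasDerivWithinAt v (dirDeriv f (seg (maxSol f U φ) s) (seg v s)) (Icc 0 T) s) ∧
      (∀ s < T, dirDeriv (solOp f U s) φ ψ = seg v s) ∧ EqOn (linSol f U φ ψ) v (Iio T) := by
  obtain ⟨T, htT, hT, v, hvc, hv0, hv, hD⟩ := exists_hasDirDeriv_solOp hU hf ψ ht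
  refine ⟨T, htT, hT, v, hvc, hv0, hv, fun s hs => (hD s hs).dirDeriv_eq, fun s hs => ?_⟩
  rcases lt_or_ge s 0 with hs0 | hs0
  · rw [linSol, dif_pos hs0]
    exact ((seg_zero_eq_iff hvc.continuousOn).1 hv0 ⟨s, hs0.le⟩).symm
  · rw [linSol, dif_neg hs0.not_gt, (hD s hs).dirDeriv_eq, seg_apply hvc, add_zero]

end Maximal

end DelayEq

theorem proposition5p2 (n : ℕ) (U : Set (DelayEq.Hist n)) (hU : IsOpen U)
    (f : DelayEq.Hist n → EuclideanSpace ℝ (Fin n))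
    (hf : DelayEq.IsC1MB f U ∨ DelayEq.IsC1F f U)
    (φ : DelayEq.Hist n) (hφ : φ ∈ U) (ψ : DelayEq.Hist n) :
    -- the maximal solution is well-defined
    (0 < DelayEq.tmax f U φ ∧
      DelayEq.IsSolution f U (DelayEq.maxSol f U φ) (DelayEq.lifespan f U φ) ∧
      DelayEq.seg (DelayEq.maxSol f U φ) 0 = φ ∧
      ∀ (T : ℝ) (x : ℝ → EuclideanSpace ℝ (Fin n)), 0 < T → (T : EReal) < DelayEq.tmax f U φ →
        DelayEq.IsSolution f U x (Icc 0 T) → DelayEq.seg x 0 = φ →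
        ∀ t ∈ Icc 0 T, x t = DelayEq.maxSol f U φ t) ∧
    -- the solution operators are defined on open sets, and their derivatives at `φ` exist
    (∀ t ∈ DelayEq.lifespan f U φ, IsOpen (DelayEq.solDomain f U t) ∧
      ∀ χ : DelayEq.Hist n, DelayEq.DirDifferentiableAt (DelayEq.solOp f U t) φ χ) ∧
    -- segments of `v`
    (∀ t ∈ DelayEq.lifespan f U φ,
      DelayEq.seg (DelayEq.linSol f U φ ψ) t = DelayEq.dirDeriv (DelayEq.solOp f U t) φ ψ) ∧
    DelayEq.seg (DelayEq.linSol f U φ ψ) 0 = ψ ∧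
    -- continuity of `v` on `(-∞, t_φ)`
    ContinuousOn (DelayEq.linSol f U φ ψ) {t : ℝ | (t : EReal) < DelayEq.tmax f U φ} ∧
    -- the variational equation on `[0, t_φ)`
    (∀ t ∈ DelayEq.lifespan f U φ,
      HasDerivWithinAt (DelayEq.linSol f U φ ψ)
        (DelayEq.dirDeriv f (DelayEq.seg (DelayEq.maxSol f U φ) t)
          (DelayEq.seg (DelayEq.linSol f U φ ψ) t))
        (DelayEq.lifespan f U φ) t) := by
  have hC : DelayEq.IsC1MB f U := hf.elim id DelayEq.IsC1F.isC1MB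
  have hpos := DelayEq.tmax_pos hU hC hφ
  have hpos' : ((0 : ℝ) : EReal) < DelayEq.tmax f U φ := by simpa using hpos
  refine ⟨⟨hpos, DelayEq.isSolution_maxSol hU hC, ?_, fun T x hT hTm hx h0 t ht => ?_⟩,
    fun t ht => ⟨DelayEq.isOpen_solDomain hU hC t, fun χ => ?_⟩, fun t ht => ?_, ?_, ?_,
    fun t ht => ?_⟩
  · obtain ⟨T, hT, -, x, -, hx, h0⟩ := DelayEq.exists_solution_of_lt_tmax hpos'
    rw [← h0]
    exact DelayEq.seg_congr
      ((DelayEq.maxSol_eqOn hU hC hT hx rfl).mono (Iic_subset_Iio.2 hT))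
  · obtain ⟨S, hTS, hS, y, -, hy, hy0⟩ := DelayEq.exists_solution_of_lt_tmax hTm
    rw [DelayEq.maxSol_eqOn hU hC hS hy hy0 (ht.2.trans_lt hTS)]
    exact hx.eqOn hU hC hT.le (hy.mono hT.le hTS.le) (h0.trans hy0.symm) ht.2
  · obtain ⟨T, htT, -, v, -, -, -, hD⟩ := DelayEq.exists_hasDirDeriv_solOp hU hC χ ht.2
    exact ⟨_, hD t htT⟩
  · obtain ⟨T, htT, -, v, -, -, -, hD, hE⟩ := DelayEq.exists_linSol_eqOn hU hC ψ ht.2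
    rw [hD t htT, DelayEq.seg_congr (hE.mono (Iic_subset_Iio.2 htT))]
  · obtain ⟨T, hT, -, v, -, hv0, -, -, hE⟩ := DelayEq.exists_linSol_eqOn hU hC ψ hpos'
    rw [DelayEq.seg_congr (hE.mono (Iic_subset_Iio.2 hT)), hv0]
  · refine DelayEq.continuousOn_of_eqOn_Iio fun t ht => ?_
    obtain ⟨T, htT, -, v, hvc, -, -, -, hE⟩ := DelayEq.exists_linSol_eqOn hU hC ψ ht
    exact ⟨T, htT, v, hvc, hE⟩
  · obtain ⟨T, htT, -, v, -, -, hv, -, hE⟩ := DelayEq.exists_linSol_eqOn hU hC ψ ht.2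
    rw [DelayEq.seg_congr (hE.mono (Iic_subset_Iio.2 htT))]
    exact DelayEq.hasDerivWithinAt_lifespan htT hE (hv t ⟨ht.1, htT.le⟩ htT)
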